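/- **Setting.** Tasks $t=1,2,\dots$ have hidden independent states $Y(t)$, uniform on $\{-1,1\}$. A committee is a sequence of experts with competences $p_1,p_2,\dots\in[0,1]$, $q_i=1-p_i$; given $Y(t)$ the opinions $X_i(t)\in\{-1,1\}$ are independent, and $X_i(t)=Y(t)$ with probability $p_i$ whatever the value of $Y(t)$; different tasks are independent. For a finite set of voters, $V$ denotes their majority vote, $V(x)=\operatorname{sign}\sum_i x_i$, with ties broken in an arbitrary manner fixed in advance. The committee is *consistent* if $P(V(X_1,\dots,X_n)=Y)\to1$ as $n\to\infty$; its *rate* is $a_N=\inf_{n\ge N}P(V(X_1,\dots,X_n)=Y)$, and $\rho_N=\frac{1-a_N}{a_N-1/2}$. It is *absolutely balanced* with parameter $\gamma\in(0,\tfrac12)$ if $p_i\in(\gamma,1-\gamma)$ for all $i$. Let $\Phi=\sum_{i=1}^N(p_i-\tfrac12)\log\frac{p_i}{q_i}$. For a committee of size $N$ and a block of $T\ge1$ tasks, the empirical pseudo competence of expert $i\le N$ is the frequency of agreement with the majority vote of the other $N-1$ members, $$\tilde p_i(T)=\frac1T\sum_{t=1}^T \mathbf 1\{X_i(t)=V((X_j(t))_{j\le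 N,\,j\ne i})\},$$ and the block empirical pseudo naïve Bayes rule is $$f^B(\mathbf X(t))=\operatorname{sign}\Big(\sum_{i=1}^N X_i(t)\,w(\tilde p_i(T))\Big),\qquad w(x)=\log\frac{x}{1-x},$$ where $\operatorname{sign}(0)\in\{-1,1\}$ and the real values that replace $w(0)$ and $w(1)$ are arbitrary. **Theorem.** For every sequence of competences $(p_i)$ there is a committee size $n^*$, depending only on $(p_i)$, such that the following holds for all $N>n^*$ if the committee is consistent with rate $a_N$. For all $T\ge 1$ and $\delta\in(0,1)$ put $C(\delta;N,T)=\frac{12}{T}\log\frac{8N}{\delta}$. For every $$\varepsilon\in\Big(\big(\rho_N\,C(\delta;N,T)\big)^{1/3},\ \min\{5,\,2\Phi/N\}\Big),$$ if the committee is absolutely balanced with a parameter $$\gamma> C(\delta;N,T)\Big(\frac{2}{\sqrt{4\varepsilon+1}-1}\Big)^2,$$ then for every task $t$ $$P\big(f^B(\mathbf X(t))\ne Y(t)\big)\le\delta+\exp\Big[-\frac{(2\Phi-\varepsilon N)^2}{8\Phi}\Big].$$ -/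

import Mathlib

open MeasureTheory ProbabilityTheory Filter Topology

noncomputable section

/-- The sign of a real number, with value `tie` at zero. -/
def signWithTie (tie x : ℝ) : ℝ :=
  if 0 < x then 1 else if x < 0 then -1 else tie

/-- The probability law of hidden binary states `Y t` of the tasks `t = 0, 1, 2, …` and of the
opinions `X i t` of the experts `i = 0, 1, 2, …` on them, for a committee with competences `p i`:
the states are uniform on `{-1, 1}`; given the state of a task, the opinions on that task are
independent, each one being equal to the state with probability `p i`; different tasks are
independent. -/
structure IsOpinionModel {Ω : Type*} [MeasurableSpace Ω] (μ : Measure Ω)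
    (p : ℕ → ℝ) (Y : ℕ → Ω → ℝ) (X : ℕ → ℕ → Ω → ℝ) : Prop where
  measurable_state : ∀ t, Measurable (Y t)
  measurable_opinion : ∀ i t, Measurable (X i t)
  state_values : ∀ t ω, Y t ω = 1 ∨ Y t ω = -1
  opinion_values : ∀ i t ω, X i t ω = 1 ∨ X i t ω = -1
  uniform_prior : ∀ t, ∀ y : ℝ, y = 1 ∨ y = -1 → μ.real {ω | Y t ω = y} = 1 / 2
  competence : ∀ i t, ∀ y : ℝ, y = 1 ∨ y = -1 →
    (μ[|{ω | Y t ω = y}]).real {ω | X i t ω = y} = p i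
  opinions_condIndep : ∀ t, ∀ y : ℝ, y = 1 ∨ y = -1 →
    iIndepFun (fun i => X i t) (μ[|{ω | Y t ω = y}])
  tasks_indep : iIndepFun (fun t ω => (Y t ω, fun i => X i t ω)) μ

/-- The majority vote of a finite set `A` of voters with opinions `x i`. A tie is broken by the
value `tie A`. -/
def majorityVote (tie : Finset ℕ → ℝ) (A : Finset ℕ) (x : ℕ → ℝ) : ℝ :=
  signWithTie (tie A) (∑ i ∈ A, x i)

/-- The probability that the majority vote of the first `n` experts is the true state. All tasks
have the same law; the task `0` is used. -/
def majorityAccuracy {Ω : Type*} [MeasurableSpace Ω] (μ : Measure Ω)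
    (Y : ℕ → Ω → ℝ) (X : ℕ → ℕ → Ω → ℝ) (tie : ℕ → Finset ℕ → ℝ) (n : ℕ) : ℝ :=
  μ.real {ω | majorityVote (tie 0) (Finset.range n) (fun i => X i 0 ω) = Y 0 ω}

/-- Consistency of the committee under majority voting. -/
def IsConsistent {Ω : Type*} [MeasurableSpace Ω] (μ : Measure Ω)
    (Y : ℕ → Ω → ℝ) (X : ℕ → ℕ → Ω → ℝ) (tie : ℕ → Finset ℕ → ℝ) : Prop :=
  Tendsto (majorityAccuracy μ Y X tie) atTop (𝓝 1)

/-- The rate of consistency `a_N = inf_{n ≥ N} P(V(X_1, …, X_n) = Y)`. -/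
def consistencyRate {Ω : Type*} [MeasurableSpace Ω] (μ : Measure Ω)
    (Y : ℕ → Ω → ℝ) (X : ℕ → ℕ → Ω → ℝ) (tie : ℕ → Finset ℕ → ℝ) (N : ℕ) : ℝ :=
  ⨅ n : Set.Ici N, majorityAccuracy μ Y X tie n

/-- `ρ_N = (1 - a_N) / (a_N - 1/2)` as a function of `a = a_N`. -/
def rateRatio (a : ℝ) : ℝ := (1 - a) / (a - 1 / 2)

/-- The committee is absolutely balanced with balancing parameter `γ`. -/
def IsAbsolutelyBalanced (p : ℕ → ℝ) (γ : ℝ) : Prop :=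
  γ ∈ Set.Ioo (0 : ℝ) (1 / 2) ∧ ∀ i, p i ∈ Set.Ioo γ (1 - γ)

/-- The committee potential `Φ` of the first `N` experts. -/
def committeePotential (p : ℕ → ℝ) (N : ℕ) : ℝ :=
  ∑ i ∈ Finset.range N, (p i - 1 / 2) * Real.log (p i / (1 - p i))

/-- `C(δ; N, T) = (12 / T) log (8 N / δ)`. -/
def sampleConstant (δ : ℝ) (N T : ℕ) : ℝ := 12 / (T : ℝ) * Real.log (8 * N / δ)

open Classical in
/-- The empirical pseudo competence of expert `i` in the committee of the first `N` experts: the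
fraction of the tasks `0, …, T - 1` on which the expert agrees with the majority vote of the other
members. -/
def empiricalPseudoCompetence {Ω : Type*} (X : ℕ → ℕ → Ω → ℝ) (tie : ℕ → Finset ℕ → ℝ)
    (N T i : ℕ) (ω : Ω) : ℝ :=
  1 / (T : ℝ) * ∑ t ∈ Finset.range T,
    if X i t ω = majorityVote (tie t) ((Finset.range N).erase i) (fun j => X j t ω)
    then (1 : ℝ) else 0

/-- The weight `log (x / (1 - x))`. It is infinite at `x = 0` and `x = 1`, where a rule has to
replace it by real values `w₀` and `w₁` of its choice. -/
def logOddsWeight (w₀ w₁ x : ℝ) : ℝ :=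
  if x = 0 then w₀ else if x = 1 then w₁ else Real.log (x / (1 - x))

/-- The decision of the block empirical pseudo naïve Bayes rule on the task `t`, with the weights
estimated over the block of tasks `0, …, T - 1`. The value `tieB` is used when the weighted sum is
zero. -/
def blockRule {Ω : Type*} (X : ℕ → ℕ → Ω → ℝ) (tie : ℕ → Finset ℕ → ℝ)
    (tieB w₀ w₁ : ℝ) (N T t : ℕ) (ω : Ω) : ℝ :=
  signWithTie tieB (∑ i ∈ Finset.range N,
    X i t ω * logOddsWeight w₀ w₁ (empiricalPseudoCompetence X tie N T i ω))

end

/-! Let A be the set of the N experts, c the mean sign of its vote margin (+1 if the majority is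
right, 0 on a tie) and c_i that of A without i. Expert i agrees with the others' vote with
probability 1/2 + (p_i - 1/2) c_i, whose log-odds is 2 artanh(c_i (2 p_i - 1)). By consistency c and
c_i are near 1, so this weight is nearly c times the Bayes weight 2 a_i, a_i = artanh(2 p_i - 1). A
common factor c does not matter to a weighted vote.

Estimation (`blockRule_error_le`). Outside an event of probability at most δ/4 all empirical weights
are within 0.97 ε of the pseudo weights, so a wrong decision forces the vote with these fixed
weights to have signed margin at most 0.97 ε N. The weights now being constant, it is irrelevant
whether the task t lies in the block.

Fixed weights (`exists_pseudo_naive_bayes_bound`). With Bayes weights, Chernoff's bound and the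
Kearns–Saul inequality give the exponent 2Φ(l² - l) + l ε N, whose minimum is the one claimed. The
pseudo weights are 2 c b_i with |b_i - a_i| ≤ η |a_i| (|tanh a_i| + D), where D is the average of
the |tanh a_j|. To first order this costs a multiple of η l ε N, covered by the spare 3% of ε. The
second-order cost, of total size η² Σ a_i⁴, is covered by the quadratic gap in the sharpened
inequality `log_cosh_sub_le`. A plain relative error η |a_i| would leave η² Σ a_i², which that gap
cannot cover when the a_i are small; hence the factor |tanh a_i| + D.

That factor comes from `abs_meanSign_erase_sub_le`: one voter matters only at near-ties, near-ties
are rare if the majority is rarely wrong, and their effect shrinks with the distance of the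
competences from 1/2. -/

/-! ### Hyperbolic inequalities and a sharpened Kearns–Saul bound. -/

theorem add_cube_div_le_sinh {y : ℝ} (hy : 0 ≤ y) : y + y ^ 3 / 6 ≤ Real.sinh y := by
  have hcosh : ∀ x : ℝ, 1 + x ^ 2 / 2 ≤ Real.cosh x := by
    intro x
    have h1 : Real.cosh x = 1 + 2 * Real.sinh (x / 2) ^ 2 := by
      have h := Real.cosh_two_mul (x / 2)
      have h' := Real.cosh_sq (x / 2)
      rw [show 2 * (x / 2) = x by ring] at h
      linarith
    have h2 : (x / 2) ^ 2 ≤ Real.sinh (x / 2) ^ 2 := by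
      rw [sq_le_sq]
      rcases le_total 0 (x / 2) with h | h
      · rw [abs_of_nonneg h, abs_of_nonneg (Real.sinh_nonneg_iff.2 h)]
        exact Real.self_le_sinh_iff.2 h
      · rw [abs_of_nonpos h, abs_of_nonpos (Real.sinh_nonpos_iff.2 h), ← Real.sinh_neg]
        exact Real.self_le_sinh_iff.2 (by linarith)
    rw [h1]
    linarith
  have hd : ∀ x : ℝ, HasDerivAt (fun x => Real.sinh x - (x + x ^ 3 / 6))
      (Real.cosh x - (1 + x ^ 2 / 2)) x := by
    intro x
    have := (Real.hasDerivAt_sinh x).sub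
      ((hasDerivAt_id' x).add (((hasDerivAt_id' x).pow 3).div_const 6))
    refine this.congr_deriv ?_
    norm_num
    ring
  have hm : Monotone (fun x => Real.sinh x - (x + x ^ 3 / 6)) :=
    monotone_of_deriv_nonneg (fun x => (hd x).differentiableAt) fun x => by
      rw [(hd x).deriv]
      linarith [hcosh x]
  have := hm hy
  simp only [Real.sinh_zero] at this
  linarith

theorem hasDerivAt_tanh_real (x : ℝ) : HasDerivAt Real.tanh (1 / Real.cosh x ^ 2) x := by
  have h := (Real.hasDerivAt_sinh x).div (Real.hasDerivAt_cosh x) (Real.cosh_pos x).ne'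
  have e : (Real.sinh / Real.cosh) = Real.tanh := by
    funext y
    simp [Real.tanh_eq_sinh_div_cosh]
  rw [e] at h
  refine h.congr_deriv ?_
  congr 1
  have := Real.cosh_sq x
  linarith

theorem tanh_nonneg_of_nonneg {x : ℝ} (hx : 0 ≤ x) : 0 ≤ Real.tanh x := by
  rw [Real.tanh_eq_sinh_div_cosh]
  exact div_nonneg (Real.sinh_nonneg_iff.2 hx) (Real.cosh_pos x).le

theorem tanh_le_self {x : ℝ} (hx : 0 ≤ x) : Real.tanh x ≤ x := by
  have hd : ∀ y : ℝ, HasDerivAt (fun y => y - Real.tanh y) (1 - 1 / Real.cosh y ^ 2) y :=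
    fun y => (hasDerivAt_id' y).sub (hasDerivAt_tanh_real y)
  have hm : Monotone (fun y => y - Real.tanh y) :=
    monotone_of_deriv_nonneg (fun y => (hd y).differentiableAt) fun y => by
      rw [(hd y).deriv, sub_nonneg, div_le_one (by have := Real.cosh_pos y; positivity)]
      nlinarith [Real.one_le_cosh y]
  have := hm hx
  simp only [Real.tanh_zero] at this
  linarith

theorem abs_tanh (x : ℝ) : |Real.tanh x| = Real.tanh |x| := by
  rcases le_total 0 x with h | h
  · rw [abs_of_nonneg h, abs_of_nonneg (tanh_nonneg_of_nonneg h)]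
  · rw [abs_of_nonpos h, Real.tanh_neg, abs_of_nonpos]
    have := tanh_nonneg_of_nonneg (neg_nonneg.2 h)
    rw [Real.tanh_neg] at this
    linarith

theorem mul_tanh_nonneg (x : ℝ) : 0 ≤ x * Real.tanh x := by
  rcases le_total 0 x with h | h
  · exact mul_nonneg h (tanh_nonneg_of_nonneg h)
  · have := mul_nonneg (neg_nonneg.2 h) (tanh_nonneg_of_nonneg (neg_nonneg.2 h))
    rwa [Real.tanh_neg, neg_mul_neg] at this

/-- On `(0, M]`, the function `tanh x / x` decreases at least as fast as a multiple of `-x ^ 2`. -/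
theorem antitoneOn_tanh_div_add_sq (M : ℝ) :
    AntitoneOn (fun x => Real.tanh x / x + 1 / (3 * Real.cosh M ^ 2) * x ^ 2) (Set.Ioc 0 M) := by
  have hd : ∀ x : ℝ, 0 < x →
      HasDerivAt (fun x => Real.tanh x / x + 1 / (3 * Real.cosh M ^ 2) * x ^ 2)
      ((1 / Real.cosh x ^ 2 * x - Real.tanh x * 1) / x ^ 2 +
        1 / (3 * Real.cosh M ^ 2) * (2 * x)) x := by
    intro x hx
    have := ((hasDerivAt_tanh_real x).div (hasDerivAt_id' x) hx.ne').add
      (((hasDerivAt_id' x).pow 2).const_mul (1 / (3 * Real.cosh M ^ 2)))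
    refine this.congr_deriv ?_
    norm_num
  refine antitoneOn_of_deriv_nonpos (convex_Ioc 0 M)
    (fun x hx => (hd x hx.1).continuousAt.continuousWithinAt)
    (fun x hx => ?_) fun x hx => ?_
  · rw [interior_Ioc] at hx
    exact (hd x hx.1).differentiableAt.differentiableWithinAt
  · rw [interior_Ioc] at hx
    obtain ⟨hx0, hxM⟩ := hx
    rw [(hd x hx0).deriv]
    have hc := Real.cosh_pos x
    have hcM := Real.cosh_pos M
    have hle : Real.cosh x ≤ Real.cosh M := by
      rw [Real.cosh_le_cosh, abs_of_pos hx0, abs_of_pos (hx0.trans hxM)]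
      exact hxM.le
    -- The cubic term of sinh 2x bounds the numerator sinh x cosh x - x of -(tanh x / x)' from below
    -- by 2x³/3.
    have hs := add_cube_div_le_sinh (y := 2 * x) (by linarith)
    rw [Real.sinh_two_mul] at hs
    have e : (1 / Real.cosh x ^ 2 * x - Real.tanh x * 1) / x ^ 2 =
        -((Real.sinh x * Real.cosh x - x) / (x ^ 2 * Real.cosh x ^ 2)) := by
      rw [Real.tanh_eq_sinh_div_cosh]
      field_simp
      ring
    have h1 : 2 / 3 * x / Real.cosh M ^ 2 ≤
        (Real.sinh x * Real.cosh x - x) / (x ^ 2 * Real.cosh x ^ 2) := by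
      calc 2 / 3 * x / Real.cosh M ^ 2 ≤ 2 / 3 * x / Real.cosh x ^ 2 := by gcongr
        _ = 2 / 3 * x ^ 3 / (x ^ 2 * Real.cosh x ^ 2) := by field_simp
        _ ≤ _ := by
          gcongr
          linarith
    have e2 : 1 / (3 * Real.cosh M ^ 2) * (2 * x) = 2 / 3 * x / Real.cosh M ^ 2 := by
      field_simp
    rw [e, e2]
    linarith

/-- Right side minus left side is smallest at v = a: its derivative at x is x times the difference
of the values at a and x of the antitone function tanh x / x + 4k x². -/
theorem log_cosh_sub_le_of_pos {M a v : ℝ} (ha : 0 < a) (haM : a ≤ M) (hv : 0 ≤ v) (hvM : v ≤ M) :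
    Real.log (Real.cosh v) - Real.log (Real.cosh a) ≤
      Real.tanh a / a / 2 * (v ^ 2 - a ^ 2)
        - 1 / (12 * Real.cosh M ^ 2) * (v ^ 2 - a ^ 2) ^ 2 := by
  set k := 1 / (12 * Real.cosh M ^ 2) with hk
  set H : ℝ → ℝ := fun v => Real.tanh a / a / 2 * (v ^ 2 - a ^ 2) - k * (v ^ 2 - a ^ 2) ^ 2 -
    Real.log (Real.cosh v) with hH
  have hd : ∀ x : ℝ, HasDerivAt H
      (Real.tanh a / a * x - 4 * k * (x ^ 2 - a ^ 2) * x - Real.tanh x) x := by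
    intro x
    have h0 : HasDerivAt (fun x : ℝ => x ^ 2 - a ^ 2) (2 * x) x := by
      simpa using ((hasDerivAt_id' x).pow 2).sub_const (a ^ 2)
    have := ((h0.const_mul (Real.tanh a / a / 2)).sub ((h0.pow 2).const_mul k)).sub
      ((Real.hasDerivAt_cosh x).log (Real.cosh_pos x).ne')
    refine this.congr_deriv ?_
    rw [Real.tanh_eq_sinh_div_cosh x]
    norm_num
    ring
  have hanti := antitoneOn_tanh_div_add_sq M
  have h4 : 1 / (3 * Real.cosh M ^ 2) = 4 * k := by
    rw [hk]
    have := Real.cosh_pos M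
    field_simp
    norm_num
  rw [h4] at hanti
  have hfac : ∀ x : ℝ, 0 < x → Real.tanh a / a * x - 4 * k * (x ^ 2 - a ^ 2) * x - Real.tanh x =
      x * ((Real.tanh a / a + 4 * k * a ^ 2) - (Real.tanh x / x + 4 * k * x ^ 2)) := by
    intro x hx
    field_simp
    ring
  have hcont : Continuous H := continuous_iff_continuousAt.2 fun x => (hd x).continuousAt
  have hHa : H a = - Real.log (Real.cosh a) := by simp [hH]
  suffices H a ≤ H v by
    rw [hHa] at this
    simp only [hH] at this
    linarith
  rcases le_total v a with hva | hav
  · have : AntitoneOn H (Set.Icc 0 a) := by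
      refine antitoneOn_of_deriv_nonpos (convex_Icc 0 a) hcont.continuousOn
        (fun x _ => (hd x).differentiableAt.differentiableWithinAt) fun x hx => ?_
      rw [interior_Icc] at hx
      rw [(hd x).deriv, hfac x hx.1]
      have := hanti ⟨hx.1, hx.2.le.trans haM⟩ ⟨ha, haM⟩ hx.2.le
      exact mul_nonpos_of_nonneg_of_nonpos hx.1.le (by linarith)
    exact this ⟨hv, hva⟩ ⟨ha.le, le_rfl⟩ hva
  · have : MonotoneOn H (Set.Icc a M) := by
      refine monotoneOn_of_deriv_nonneg (convex_Icc a M) hcont.continuousOn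
        (fun x _ => (hd x).differentiableAt.differentiableWithinAt) fun x hx => ?_
      rw [interior_Icc] at hx
      have hx0 : 0 < x := ha.trans hx.1
      rw [(hd x).deriv, hfac x hx0]
      have := hanti ⟨ha, haM⟩ ⟨hx0, hx.2.le⟩ hx.1.le
      exact mul_nonneg hx0.le (by linarith)
    exact this ⟨le_rfl, haM⟩ ⟨hav, hvM⟩ hav

/-- A strengthened form of the Kearns–Saul inequality: the concave function `log (cosh √y)` lies
below its tangent at `a ^ 2`, with a quadratic gap on bounded sets. -/
theorem log_cosh_sub_le {M a v : ℝ} (ha : a ≠ 0) (haM : |a| ≤ M) (hvM : |v| ≤ M) :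
    Real.log (Real.cosh v) - Real.log (Real.cosh a) ≤
      Real.tanh a / a / 2 * (v ^ 2 - a ^ 2)
        - 1 / (12 * Real.cosh M ^ 2) * (v ^ 2 - a ^ 2) ^ 2 := by
  have h := log_cosh_sub_le_of_pos (abs_pos.2 ha) haM (abs_nonneg v) hvM
  have e : Real.tanh |a| / |a| = Real.tanh a / a := by
    rcases abs_cases a with ⟨h, _⟩ | ⟨h, _⟩
    · rw [h]
    · rw [h, Real.tanh_neg, neg_div_neg_eq]
  simpa only [Real.cosh_abs, sq_abs, e] using h

/-! ### Estimates for log-odds and artanh. -/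

/-- The derivative of the difference has the sign of 4 - x - 4x² for x > 0; the positive root of
this polynomial is about 0.8828, which explains 22/25. -/
theorem log_one_add_div_one_sub_le {r : ℝ} (hr : 0 ≤ r) (hr' : r ≤ 22 / 25) :
    Real.log ((1 + r) / (1 - r)) ≤ 2 * r + 4 * r ^ 2 := by
  have hd : ∀ x ∈ Set.Icc (0 : ℝ) (22 / 25),
      HasDerivAt (fun x => 2 * x + 4 * x ^ 2 - (Real.log (1 + x) - Real.log (1 - x)))
      (2 + 8 * x - (1 / (1 + x) + 1 / (1 - x))) x := by
    intro x hx
    have h1 : (1 + x) ≠ 0 := by linarith [hx.1]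
    have h2 : (1 - x) ≠ 0 := by linarith [hx.2]
    have := (((hasDerivAt_id' x).const_mul 2).add (((hasDerivAt_id' x).pow 2).const_mul 4)).sub
      ((((hasDerivAt_id' x).const_add 1).log h1).sub (((hasDerivAt_id' x).const_sub 1).log h2))
    refine this.congr_deriv ?_
    norm_num
    ring
  have hm : MonotoneOn (fun x => 2 * x + 4 * x ^ 2 - (Real.log (1 + x) - Real.log (1 - x)))
      (Set.Icc (0 : ℝ) (22 / 25)) := by
    refine monotoneOn_of_deriv_nonneg (convex_Icc _ _)
      (fun x hx => (hd x hx).continuousAt.continuousWithinAt)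
      (fun x hx => (hd x (interior_subset hx)).differentiableAt.differentiableWithinAt)
      fun x hx => ?_
    have hx' := interior_subset hx
    rw [(hd x hx').deriv]
    have h1 : 0 < 1 + x := by linarith [hx'.1]
    have h2 : 0 < 1 - x := by linarith [hx'.2]
    have e : 1 / (1 + x) + 1 / (1 - x) = 2 / ((1 + x) * (1 - x)) := by
      field_simp
      ring
    rw [e, sub_nonneg, div_le_iff₀ (by positivity)]
    have : 0 ≤ x * (4 - x - 4 * x ^ 2) := by
      refine mul_nonneg hx'.1 ?_
      nlinarith [hx'.1, hx'.2]
    nlinarith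
  have := hm ⟨le_rfl, by norm_num⟩ ⟨hr, hr'⟩ hr
  norm_num at this
  rw [Real.log_div (by linarith) (by linarith)]
  linarith

theorem hasDerivAt_artanh {x : ℝ} (hx : x ∈ Set.Ioo (-1 : ℝ) 1) :
    HasDerivAt Real.artanh (1 / (1 - x ^ 2)) x := by
  have h1 : (1 + x) ≠ 0 := by linarith [hx.1]
  have h2 : (1 - x) ≠ 0 := by linarith [hx.2]
  have h := ((((hasDerivAt_id' x).const_add 1).log h1).sub
    (((hasDerivAt_id' x).const_sub 1).log h2)).const_mul (1 / 2)
  have h3 : HasDerivAt (fun y => 1 / 2 * (Real.log (1 + y) - Real.log (1 - y)))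
      (1 / (1 - x ^ 2)) x := by
    refine h.congr_deriv ?_
    have : (1 - x ^ 2) ≠ 0 := by
      rw [show 1 - x ^ 2 = (1 + x) * (1 - x) by ring]
      exact mul_ne_zero h1 h2
    field_simp
    ring
  refine h3.congr_of_eventuallyEq ?_
  filter_upwards [isOpen_Ioo.mem_nhds hx] with y hy
  rw [Real.artanh_eq_half_log ⟨hy.1.le, hy.2.le⟩,
    Real.log_div (by linarith [hy.1]) (by linarith [hy.2])]

theorem artanh_neg_real (x : ℝ) (hx : x ∈ Set.Ioo (-1 : ℝ) 1) :
    Real.artanh (-x) = - Real.artanh x := by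
  apply Real.tanh_injective
  rw [Real.tanh_neg, Real.tanh_artanh hx, Real.tanh_artanh ⟨by linarith [hx.2], by linarith [hx.1]⟩]

theorem self_le_artanh {x : ℝ} (hx : 0 ≤ x) (hx1 : x < 1) : x ≤ Real.artanh x := by
  have := tanh_le_self (Real.artanh_nonneg hx)
  rwa [Real.tanh_artanh ⟨by linarith, hx1⟩] at this

theorem abs_artanh (x : ℝ) (hx : x ∈ Set.Ioo (-1 : ℝ) 1) : |Real.artanh x| = Real.artanh |x| := by
  rcases le_total 0 x with h | h
  · rw [abs_of_nonneg h, abs_of_nonneg (Real.artanh_nonneg h)]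
  · rw [abs_of_nonpos h, abs_of_nonpos (Real.artanh_nonpos h), artanh_neg_real x hx]

/-- Both functions have slope 1 at 0, so they differ only to third order. Writing m³ = m² · m and
using m ≤ artanh m turns the cubic error into a relative one. -/
theorem artanh_mul_div_sub_of_nonneg {c m : ℝ} (hc : 0 < c) (hc1 : c ≤ 1) (hm : 0 ≤ m)
    (hm1 : m < 1) :
    Real.artanh (c * m) / c ≤ Real.artanh m ∧
    Real.artanh m - Real.artanh (c * m) / c ≤
      (1 - c ^ 2) * m ^ 2 / (1 - m ^ 2) ^ 2 * Real.artanh m := by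
  have hd : ∀ x ∈ Set.Icc 0 m, HasDerivAt (fun x => Real.artanh x - Real.artanh (c * x) / c)
      (1 / (1 - x ^ 2) - 1 / (1 - (c * x) ^ 2)) x := by
    intro x hx
    have hcx : c * x ≤ x := mul_le_of_le_one_left hx.1 hc1
    have hcx0 : 0 ≤ c * x := mul_nonneg hc.le hx.1
    have h1 := hasDerivAt_artanh (x := x) ⟨by linarith [hx.1], by linarith [hx.2]⟩
    have h2 := hasDerivAt_artanh (x := c * x) ⟨by linarith, by linarith [hx.2]⟩
    have := h1.sub ((h2.comp x ((hasDerivAt_id' x).const_mul c)).div_const c)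
    refine this.congr_deriv ?_
    field_simp
  have key : ∀ x ∈ Set.Icc 0 m, 1 / (1 - x ^ 2) - 1 / (1 - (c * x) ^ 2) =
      (1 - c ^ 2) * x ^ 2 / ((1 - x ^ 2) * (1 - (c * x) ^ 2)) ∧ 1 - m ^ 2 ≤ 1 - x ^ 2 ∧
      1 - x ^ 2 ≤ 1 - (c * x) ^ 2 ∧ 0 < 1 - m ^ 2 := by
    intro x hx
    have h0 : 0 < 1 - m ^ 2 := by nlinarith
    have h1 : 1 - m ^ 2 ≤ 1 - x ^ 2 := by nlinarith [hx.1, hx.2]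
    have h2 : 1 - x ^ 2 ≤ 1 - (c * x) ^ 2 := by
      have : (c * x) ^ 2 ≤ x ^ 2 :=
        pow_le_pow_left₀ (mul_nonneg hc.le hx.1) (mul_le_of_le_one_left hx.1 hc1) 2
      linarith
    have h3 : 1 - x ^ 2 ≠ 0 := by linarith
    have h4 : 1 - (c * x) ^ 2 ≠ 0 := by linarith
    refine ⟨?_, h1, h2, h0⟩
    rw [div_sub_div _ _ h3 h4]
    congr 1
    ring
  have hc2 : 0 ≤ 1 - c ^ 2 := by nlinarith
  have hmm : m ∈ Set.Icc 0 m := ⟨hm, le_rfl⟩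
  have h0m : (0 : ℝ) ∈ Set.Icc 0 m := ⟨le_rfl, hm⟩
  constructor
  · have : MonotoneOn (fun x => Real.artanh x - Real.artanh (c * x) / c) (Set.Icc 0 m) := by
      refine monotoneOn_of_deriv_nonneg (convex_Icc _ _)
        (fun x hx => (hd x hx).continuousAt.continuousWithinAt)
        (fun x hx => (hd x (interior_subset hx)).differentiableAt.differentiableWithinAt)
        fun x hx => ?_
      have hx' := interior_subset hx
      rw [(hd x hx').deriv]
      obtain ⟨h1, h2, h3, h4⟩ := key x hx'
      rw [h1]
      exact div_nonneg (by positivity) (mul_nonneg (by linarith) (by linarith))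
    have := this h0m hmm hm
    norm_num at this
    exact this
  · set K := (1 - c ^ 2) / (1 - m ^ 2) ^ 2 with hK
    have hK0 : 0 ≤ K := by positivity
    have hd' : ∀ x ∈ Set.Icc 0 m, HasDerivAt
        (fun x => K * x ^ 3 - (Real.artanh x - Real.artanh (c * x) / c))
        (K * (3 * x ^ 2) - (1 / (1 - x ^ 2) - 1 / (1 - (c * x) ^ 2))) x := by
      intro x hx
      have := (((hasDerivAt_id' x).pow 3).const_mul K).sub (hd x hx)
      refine this.congr_deriv ?_
      norm_num
    have : MonotoneOn (fun x => K * x ^ 3 - (Real.artanh x - Real.artanh (c * x) / c))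
        (Set.Icc 0 m) := by
      refine monotoneOn_of_deriv_nonneg (convex_Icc _ _)
        (fun x hx => (hd' x hx).continuousAt.continuousWithinAt)
        (fun x hx => (hd' x (interior_subset hx)).differentiableAt.differentiableWithinAt)
        fun x hx => ?_
      have hx' := interior_subset hx
      rw [(hd' x hx').deriv]
      obtain ⟨h1, h2, h3, h4⟩ := key x hx'
      rw [h1]
      have h5 : (1 - c ^ 2) * x ^ 2 / ((1 - x ^ 2) * (1 - (c * x) ^ 2)) ≤
          (1 - c ^ 2) * x ^ 2 / (1 - m ^ 2) ^ 2 := by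
        rw [sq (1 - m ^ 2)]
        apply div_le_div_of_nonneg_left (by positivity) (by positivity)
        exact mul_le_mul h2 (h2.trans h3) h4.le (h4.le.trans h2)
      have h6 : (1 - c ^ 2) * x ^ 2 / (1 - m ^ 2) ^ 2 = K * x ^ 2 := by
        rw [hK]
        ring
      have : 0 ≤ K * x ^ 2 := by positivity
      linarith
    have := this h0m hmm hm
    norm_num at this
    have h7 : K * m ^ 3 ≤ (1 - c ^ 2) * m ^ 2 / (1 - m ^ 2) ^ 2 * Real.artanh m := by
      have : (1 - c ^ 2) * m ^ 2 / (1 - m ^ 2) ^ 2 * Real.artanh m =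
        K * m ^ 2 * Real.artanh m := by
        rw [hK]
        ring
      rw [this, pow_succ m 2, ← mul_assoc]
      exact mul_le_mul_of_nonneg_left (self_le_artanh hm hm1) (by positivity)
    linarith

theorem abs_artanh_mul_div_sub_le {c m : ℝ} (hc : 0 < c) (hc1 : c ≤ 1)
    (hm : m ∈ Set.Ioo (-1 : ℝ) 1) :
    |Real.artanh (c * m) / c - Real.artanh m| ≤
      (1 - c ^ 2) * m ^ 2 / (1 - m ^ 2) ^ 2 * |Real.artanh m| ∧
    |Real.artanh (c * m) / c| ≤ |Real.artanh m| := by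
  have hcm : c * m ∈ Set.Ioo (-1 : ℝ) 1 := by
    rw [Set.mem_Ioo, ← abs_lt, abs_mul, abs_of_pos hc]
    have := abs_lt.2 hm
    nlinarith [abs_nonneg m]
  obtain ⟨h1, h2⟩ := artanh_mul_div_sub_of_nonneg hc hc1 (abs_nonneg m) (abs_lt.2 hm)
  rw [sq_abs, ← abs_artanh m hm] at h2
  have h3 : Real.artanh (c * |m|) = |Real.artanh (c * m)| := by
    rw [abs_artanh _ hcm, abs_mul, abs_of_pos hc]
  rw [h3, ← abs_artanh m hm] at h1
  rw [h3] at h2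
  refine ⟨?_, ?_⟩
  · refine le_trans ?_ h2
    rcases le_total 0 m with h | h
    · have e1 := Real.artanh_nonneg h
      have e2 := Real.artanh_nonneg (mul_nonneg hc.le h)
      rw [abs_of_nonneg e1, abs_of_nonneg e2] at h1
      rw [abs_of_nonneg e1, abs_of_nonneg e2, abs_of_nonpos (by linarith)]
      linarith
    · have e1 := Real.artanh_nonpos h
      have e2 := Real.artanh_nonpos (mul_nonpos_of_nonneg_of_nonpos hc.le h)
      rw [abs_of_nonpos e1, abs_of_nonpos e2, neg_div] at h1
      rw [abs_of_nonpos e1, abs_of_nonpos e2, neg_div, abs_of_nonneg (by linarith)]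
      linarith
  · rwa [abs_div, abs_of_pos hc]

/-! ### Exponential moments of a Bernoulli variable and of a weighted vote. -/

/-- Bound for the cumulant of a centred Bernoulli variable. -/
theorem bernoulli_mgf_le {q l : ℝ} (hq : q ∈ Set.Icc (0 : ℝ) 1) (hl : |l| ≤ 1) :
    q * Real.exp (l * (1 - q)) + (1 - q) * Real.exp (l * (0 - q)) ≤
      Real.exp (q * (l ^ 2 / 2 + 2 / 9 * |l| ^ 3)) := by
  have h1 : q * Real.exp (l * (1 - q)) + (1 - q) * Real.exp (l * (0 - q)) =
      (q * (Real.exp l - 1) + 1) * Real.exp (-(q * l)) := by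
    rw [show l * (1 - q) = l + -(q * l) by ring, show l * (0 - q) = -(q * l) by ring, Real.exp_add]
    ring
  -- The remainder constant at order three is 4 / (3! · 3) = 2/9.
  have h2 : Real.exp l - 1 - l ≤ l ^ 2 / 2 + 2 / 9 * |l| ^ 3 := by
    have := Real.exp_bound hl (n := 3) (by norm_num)
    norm_num [Finset.sum_range_succ] at this
    have := (abs_le.1 this).2
    linarith
  calc _ = (q * (Real.exp l - 1) + 1) * Real.exp (-(q * l)) := h1
    _ ≤ Real.exp (q * (Real.exp l - 1)) * Real.exp (-(q * l)) := by
        gcongr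
        exact Real.add_one_le_exp _
    _ = Real.exp (q * (Real.exp l - 1 - l)) := by
        rw [← Real.exp_add]
        ring_nf
    _ ≤ _ := by
        gcongr
        exact hq.1

theorem bernoulli_mgf_le_min {q l : ℝ} (hq : q ∈ Set.Icc (0 : ℝ) 1) (hl : |l| ≤ 1) :
    q * Real.exp (l * (1 - q)) + (1 - q) * Real.exp (l * (0 - q)) ≤
      Real.exp (min q (1 - q) * (l ^ 2 / 2 + 2 / 9 * |l| ^ 3)) := by
  rcases le_total q (1 - q) with h | h
  · rw [min_eq_left h]
    exact bernoulli_mgf_le hq hl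
  · rw [min_eq_right h]
    have := bernoulli_mgf_le (q := 1 - q) (l := -l) ⟨by linarith [hq.2], by linarith [hq.1]⟩
      (by rwa [abs_neg])
    rw [abs_neg, neg_sq] at this
    refine le_trans (le_of_eq ?_) this
    rw [add_comm]
    congr 2 <;> ring_nf

/-- A competence written as (1 + tanh a) / 2 turns a Chernoff factor into a ratio of hyperbolic
cosines, ready for the bound on log cosh. -/
theorem cosh_sub_two_mul_div_cosh {a u : ℝ} :
    (1 + Real.tanh a) / 2 * Real.exp (-u) + (1 - Real.tanh a) / 2 * Real.exp u =
      Real.cosh (a - u) / Real.cosh a := by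
  have := Real.cosh_pos a
  rw [Real.cosh_sub, Real.tanh_eq_sinh_div_cosh, ← Real.cosh_sub_sinh u, ← Real.cosh_add_sinh u]
  field_simp
  ring

/-- The cumulant bound for one expert whose weight `b` is a perturbation of the ideal weight `a`. -/
theorem log_cosh_sub_two_mul_le {M a b D η l : ℝ} (haM : |a| ≤ M) (hη0 : 0 ≤ η)
    (hη : η ≤ 1 / 100) (hl0 : 0 < l) (hl : l ≤ 1 / 2) (hD1 : D ≤ 1)
    (hb : |b - a| ≤ η * |a| * (|Real.tanh a| + D)) :
    Real.log (Real.cosh (a - 2 * l * b) / Real.cosh a) ≤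
      2 * (a * Real.tanh a) * (l ^ 2 - l + 2 * η * l * (1 - 2 * l)) +
        l ^ 2 * (4 * η ^ 2 * (a ^ 2 * (a ^ 2 + D ^ 2)) -
          3 / (12 * Real.cosh (3 * M) ^ 2) * a ^ 4) := by
  rcases eq_or_ne a 0 with rfl | ha
  · have hb0 : b = 0 := by simpa using hb
    simp [hb0]
  have ha0 := abs_pos.2 ha
  have hcM := Real.cosh_pos (3 * M)
  set k := 1 / (12 * Real.cosh (3 * M) ^ 2) with hk
  have hk0 : 0 ≤ k := by positivity
  have h3k : 3 / (12 * Real.cosh (3 * M) ^ 2) = 3 * k := by rw [hk]; ring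
  rw [h3k, Real.log_div (Real.cosh_pos _).ne' (Real.cosh_pos _).ne']
  set d := b - a with hd
  have hbd : b = a + d := by rw [hd]; ring
  have htanh : |Real.tanh a| ≤ |a| := by
    rw [abs_tanh]
    exact tanh_le_self (abs_nonneg a)
  have htanh1 : |Real.tanh a| ≤ 1 := (Real.abs_tanh_lt_one a).le
  have hd1 : |d| ≤ 2 * η * |a| := by
    refine hb.trans ?_
    have : η * |a| * (|Real.tanh a| + D) ≤ η * |a| * 2 := by gcongr; linarith
    linarith
  have hd2 : |d| ≤ 1 / 50 * |a| := hd1.trans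
    (mul_le_mul_of_nonneg_right (by linarith) (abs_nonneg a))
  have hd3 : d ^ 2 ≤ 2 * η ^ 2 * (a ^ 2 * (a ^ 2 + D ^ 2)) := by
    have h1 : |d| ≤ η * |a| * (|a| + D) := hb.trans (by gcongr)
    have h2 := pow_le_pow_left₀ (abs_nonneg d) h1 2
    rw [sq_abs] at h2
    have h3 : (|a| + D) ^ 2 ≤ 2 * (a ^ 2 + D ^ 2) := by
      have := two_mul_le_add_sq |a| D
      rw [sq_abs] at this
      rw [add_sq, sq_abs]
      linarith
    calc d ^ 2 ≤ η ^ 2 * |a| ^ 2 * (|a| + D) ^ 2 := by rw [← mul_pow, ← mul_pow]; exact h2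
      _ ≤ η ^ 2 * |a| ^ 2 * (2 * (a ^ 2 + D ^ 2)) := by gcongr
      _ = _ := by rw [sq_abs]; ring
  have hb1 : |b| ≤ 51 / 50 * |a| := by
    rw [hbd]
    linarith [abs_add_le a d]
  have hb2 : 49 / 50 * |a| ≤ |b| := by
    have := abs_sub_abs_le_abs_sub a b
    rw [abs_sub_comm a b] at this
    linarith
  -- The perturbed argument leaves [-M, M], hence the constant at 3M.
  have hv : |a - 2 * l * b| ≤ 3 * M := by
    have h1 := abs_sub a (2 * l * b)
    rw [abs_mul, abs_of_pos (by linarith : (0 : ℝ) < 2 * l)] at h1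
    have h2 : 2 * l * |b| ≤ 1 * |b| := by gcongr; linarith
    linarith
  have hmain := log_cosh_sub_le (M := 3 * M) ha (by linarith) hv
  rw [← hk] at hmain
  set t := Real.tanh a / a with ht
  have hta : Real.tanh a = t * a := by rw [ht]; field_simp
  have ht0 : 0 ≤ t := by
    have e : t = a * Real.tanh a / a ^ 2 := by rw [ht]; field_simp
    rw [e]
    exact div_nonneg (mul_tanh_nonneg a) (sq_nonneg a)
  have ht1 : t ≤ 1 := by
    have h1 : |t| * |a| ≤ 1 * |a| := by
      rw [← abs_mul, ← hta, one_mul]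
      exact htanh
    exact (le_abs_self t).trans (le_of_mul_le_mul_right h1 ha0)
  -- The gap is (2lb)² (2a - 2lb)², and both |b| and |2a - 2lb| are at least (49/50)|a|; 4 ·
  -- (49/50)⁴ > 3.
  have hslack : 3 * l ^ 2 * a ^ 4 ≤ ((a - 2 * l * b) ^ 2 - a ^ 2) ^ 2 := by
    have e : ((a - 2 * l * b) ^ 2 - a ^ 2) ^ 2 = (2 * l * |b|) ^ 2 * |2 * a - 2 * l * b| ^ 2 := by
      rw [mul_pow, sq_abs, sq_abs]
      ring
    have h1 : 49 / 50 * |a| ≤ |2 * a - 2 * l * b| := by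
      have h2 := abs_sub_abs_le_abs_sub (2 * a) (2 * l * b)
      rw [abs_mul, abs_mul (2 * l) b, abs_of_pos (by linarith : (0 : ℝ) < 2 * l)] at h2
      have h3 : 2 * l * |b| ≤ 1 * |b| := by gcongr; linarith
      norm_num at h2
      linarith
    rw [e]
    calc 3 * l ^ 2 * a ^ 4 ≤ (2 * l * (49 / 50 * |a|)) ^ 2 * (49 / 50 * |a|) ^ 2 := by
          have : (2 * l * (49 / 50 * |a|)) ^ 2 * (49 / 50 * |a|) ^ 2 =
            4 * (49 / 50) ^ 4 * (l ^ 2 * (|a| ^ 2) ^ 2) := by ring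
          rw [this, sq_abs]
          rw [show 3 * l ^ 2 * a ^ 4 = 3 * (l ^ 2 * (a ^ 2) ^ 2) by ring]
          gcongr
          norm_num
      _ ≤ _ := by gcongr
  -- The expansion in d is exact. The factor 1 - 2l of the linear term matters: at the optimal l it
  -- equals ε N / (2Φ), so this error is measured in ε N and not in Φ.
  have hquad : t / 2 * ((a - 2 * l * b) ^ 2 - a ^ 2) =
      2 * (a * Real.tanh a) * (l ^ 2 - l) + 2 * l * (1 - 2 * l) * (t * (a * -d)) +
        2 * l ^ 2 * (t * d ^ 2) := by
    rw [hta, hbd]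
    ring
  have hlin : t * (a * -d) ≤ 2 * η * (a * Real.tanh a) := by
    have h1 : a * -d ≤ 2 * η * a ^ 2 := by
      calc a * -d ≤ |a * -d| := le_abs_self _
        _ = |a| * |d| := by rw [abs_mul, abs_neg]
        _ ≤ |a| * (2 * η * |a|) := by gcongr
        _ = 2 * η * |a| ^ 2 := by ring
        _ = _ := by rw [sq_abs]
    have h2 := mul_le_mul_of_nonneg_left h1 ht0
    rw [hta]
    linarith
  have h1 : 2 * l * (1 - 2 * l) * (t * (a * -d)) ≤
      2 * l * (1 - 2 * l) * (2 * η * (a * Real.tanh a)) := by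
    have : 0 ≤ 1 - 2 * l := by linarith
    gcongr
  have h2 : t * d ^ 2 ≤ 2 * η ^ 2 * (a ^ 2 * (a ^ 2 + D ^ 2)) := by
    have := mul_le_mul_of_nonneg_right ht1 (sq_nonneg d)
    linarith
  have h3 : 2 * l ^ 2 * (t * d ^ 2) ≤ 2 * l ^ 2 * (2 * η ^ 2 * (a ^ 2 * (a ^ 2 + D ^ 2))) := by
    gcongr
  have h4 : k * (3 * l ^ 2 * a ^ 4) ≤ k * ((a - 2 * l * b) ^ 2 - a ^ 2) ^ 2 := by gcongr
  rw [hquad] at hmain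
  linarith

/-- Cauchy–Schwarz twice. It lets the errors due to the average D be paid for by fourth powers, in
total though not for each expert: D may be larger than a given |a i|. -/
theorem sum_sq_mul_sq_avg_le (N : ℕ) (a g : ℕ → ℝ) (hg : ∀ i, 0 ≤ g i) (hga : ∀ i, g i ≤ |a i|) :
    ∑ i ∈ Finset.range N, a i ^ 2 * ((∑ j ∈ Finset.range N, g j) / N) ^ 2 ≤
      ∑ i ∈ Finset.range N, a i ^ 4 := by
  rcases Nat.eq_zero_or_pos N with rfl | hN
  · simp
  have hN' : (0 : ℝ) < N := by exact_mod_cast hN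
  have h1 : (∑ j ∈ Finset.range N, g j) ^ 2 ≤ N * ∑ j ∈ Finset.range N, a j ^ 2 := by
    calc (∑ j ∈ Finset.range N, g j) ^ 2 ≤ N * ∑ j ∈ Finset.range N, g j ^ 2 := by
          simpa using sq_sum_le_card_mul_sum_sq (s := Finset.range N) (f := g)
      _ ≤ _ := by
          refine mul_le_mul_of_nonneg_left (Finset.sum_le_sum fun i _ => ?_) hN'.le
          rw [← sq_abs (a i)]
          exact pow_le_pow_left₀ (hg i) (hga i) 2
  have h2 : (∑ j ∈ Finset.range N, a j ^ 2) ^ 2 ≤ N * ∑ j ∈ Finset.range N, a j ^ 4 := by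
    have := sq_sum_le_card_mul_sum_sq (s := Finset.range N) (f := fun j => a j ^ 2)
    simpa [← pow_mul] using this
  rw [← Finset.sum_mul, div_pow]
  have h0 : 0 ≤ ∑ j ∈ Finset.range N, a j ^ 2 := Finset.sum_nonneg fun i _ => sq_nonneg _
  calc _ ≤ (∑ j ∈ Finset.range N, a j ^ 2) * ((N * ∑ j ∈ Finset.range N, a j ^ 2) / (N : ℝ) ^ 2) :=
        by gcongr
    _ = (∑ j ∈ Finset.range N, a j ^ 2) ^ 2 / N := by field_simp
    _ ≤ _ := by
      rw [div_le_iff₀ hN']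
      linarith

theorem prod_cosh_div_cosh_le (N : ℕ) (a b : ℕ → ℝ) {M η l : ℝ}
    (haM : ∀ i, |a i| ≤ M) (hη0 : 0 ≤ η)
    (hη : η ≤ 1 / 100) (hη2 : η ^ 2 ≤ 1 / (48 * Real.cosh (3 * M) ^ 2))
    (hl0 : 0 < l) (hl : l ≤ 1 / 2)
    (hb : ∀ i ∈ Finset.range N, |b i - a i| ≤ η * |a i| *
      (|Real.tanh (a i)| + (∑ j ∈ Finset.range N, |Real.tanh (a j)|) / N)) :
    ∏ i ∈ Finset.range N, (Real.cosh (a i - 2 * l * b i) / Real.cosh (a i)) ≤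
      Real.exp ((∑ i ∈ Finset.range N, 2 * (a i * Real.tanh (a i))) *
        (l ^ 2 - l + 2 * η * l * (1 - 2 * l))) := by
  set D := (∑ j ∈ Finset.range N, |Real.tanh (a j)|) / N with hD
  have hD0 : 0 ≤ D := by positivity
  have hD1 : D ≤ 1 := by
    refine div_le_one_of_le₀ ?_ (by positivity)
    calc ∑ j ∈ Finset.range N, |Real.tanh (a j)| ≤ ∑ j ∈ Finset.range N, (1 : ℝ) :=
          Finset.sum_le_sum fun i _ => (Real.abs_tanh_lt_one _).le
      _ = N := by simp
  have h1 : ∀ i ∈ Finset.range N, Real.cosh (a i - 2 * l * b i) / Real.cosh (a i) ≤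
      Real.exp (2 * (a i * Real.tanh (a i)) * (l ^ 2 - l + 2 * η * l * (1 - 2 * l)) +
        l ^ 2 * (4 * η ^ 2 * (a i ^ 2 * (a i ^ 2 + D ^ 2)) -
          3 / (12 * Real.cosh (3 * M) ^ 2) * a i ^ 4)) := by
    intro i hi
    have := log_cosh_sub_two_mul_le (haM i) hη0 hη hl0 hl hD1 (hb i hi)
    rwa [Real.log_le_iff_le_exp (div_pos (Real.cosh_pos _) (Real.cosh_pos _))] at this
  refine (Finset.prod_le_prod (fun i _ => (div_pos (Real.cosh_pos _) (Real.cosh_pos _)).le)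
    h1).trans ?_
  rw [← Real.exp_sum, Real.exp_le_exp, Finset.sum_add_distrib, ← Finset.sum_mul]
  -- The second-order errors sum to at most 8η² Σ a⁴, while the gaps give at least 12η² Σ a⁴ by
  -- `hη2`.
  have h2 : ∑ i ∈ Finset.range N, l ^ 2 * (4 * η ^ 2 * (a i ^ 2 * (a i ^ 2 + D ^ 2)) -
          3 / (12 * Real.cosh (3 * M) ^ 2) * a i ^ 4) ≤ 0 := by
    rw [← Finset.mul_sum]
    refine mul_nonpos_of_nonneg_of_nonpos (sq_nonneg l) ?_
    have h3 := sum_sq_mul_sq_avg_le N a (fun j => |Real.tanh (a j)|) (fun j => abs_nonneg _)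
      (fun j => by simpa only [abs_tanh] using tanh_le_self (abs_nonneg (a j)))
    simp only [← hD] at h3
    have e : ∑ i ∈ Finset.range N, (4 * η ^ 2 * (a i ^ 2 * (a i ^ 2 + D ^ 2)) -
          3 / (12 * Real.cosh (3 * M) ^ 2) * a i ^ 4) =
        4 * η ^ 2 * (∑ i ∈ Finset.range N, a i ^ 4 + ∑ i ∈ Finset.range N, a i ^ 2 * D ^ 2) -
          3 / (12 * Real.cosh (3 * M) ^ 2) * ∑ i ∈ Finset.range N, a i ^ 4 := by
      rw [Finset.sum_sub_distrib, ← Finset.sum_add_distrib, Finset.mul_sum, Finset.mul_sum]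
      congr 1
      exact Finset.sum_congr rfl fun i _ => by ring
    rw [e]
    have h4 : 0 ≤ ∑ i ∈ Finset.range N, a i ^ 4 := Finset.sum_nonneg fun i _ => by positivity
    have hcM := Real.cosh_pos (3 * M)
    have e2 : 3 / (12 * Real.cosh (3 * M) ^ 2) = 12 * (1 / (48 * Real.cosh (3 * M) ^ 2)) := by
      field_simp
      norm_num
    rw [e2]
    have h5 : 4 * η ^ 2 * (∑ i ∈ Finset.range N, a i ^ 4 + ∑ i ∈ Finset.range N, a i ^ 2 * D ^ 2)
        ≤ 4 * η ^ 2 * (2 * ∑ i ∈ Finset.range N, a i ^ 4) := by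
      gcongr
      linarith
    nlinarith
  linarith

/-! ### The random set of correct voters and its margin. -/

noncomputable section

/-- The expectation of `f S` for the random set `S ⊆ A` that contains each `i ∈ A` independently
with probability `p i`. -/
def subsetExp (p : ℕ → ℝ) (A : Finset ℕ) (f : Finset ℕ → ℝ) : ℝ :=
  ∑ S ∈ A.powerset, (∏ i ∈ S, p i) * (∏ i ∈ A \ S, (1 - p i)) * f S

/-- The margin `#S - #(A \ S)` of the vote in which `S ⊆ A` is the set of correct voters. -/
def margin (A S : Finset ℕ) : ℤ := 2 * S.card - A.card

/-- The expectation of a function of the margin. -/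
def marginExp (p : ℕ → ℝ) (A : Finset ℕ) (g : ℤ → ℝ) : ℝ :=
  subsetExp p A fun S => g (margin A S)

/-- The expected sign of the margin. -/
def meanSign (p : ℕ → ℝ) (A : Finset ℕ) : ℝ := marginExp p A fun s => (s.sign : ℝ)

theorem subsetExp_congr {p : ℕ → ℝ} {A : Finset ℕ} {f g : Finset ℕ → ℝ}
    (h : ∀ S ⊆ A, f S = g S) : subsetExp p A f = subsetExp p A g :=
  Finset.sum_congr rfl fun S hS => by rw [h S (Finset.mem_powerset.1 hS)]

theorem subsetExp_empty (p : ℕ → ℝ) (f : Finset ℕ → ℝ) : subsetExp p ∅ f = f ∅ := by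
  simp [subsetExp]

theorem subsetExp_insert (p : ℕ → ℝ) {A : Finset ℕ} {i : ℕ} (hi : i ∉ A) (f : Finset ℕ → ℝ) :
    subsetExp p (insert i A) f =
      p i * subsetExp p A (fun S => f (insert i S)) + (1 - p i) * subsetExp p A f := by
  unfold subsetExp
  rw [Finset.sum_powerset_insert hi, add_comm, Finset.mul_sum, Finset.mul_sum]
  congr 1
  · refine Finset.sum_congr rfl fun S hS => ?_
    have hSA := Finset.mem_powerset.1 hS
    have hiS : i ∉ S := fun h => hi (hSA h)
    rw [Finset.prod_insert hiS]
    have : insert i A \ insert i S = A \ S := by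
      ext x
      simp only [Finset.mem_sdiff, Finset.mem_insert]
      constructor
      · rintro ⟨rfl | h, h'⟩
        · simp at h'
        · exact ⟨h, fun h2 => h' (Or.inr h2)⟩
      · rintro ⟨h, h'⟩
        exact ⟨Or.inr h, by rintro (rfl | h2); exacts [hi h, h' h2]⟩
    rw [this]
    ring
  · refine Finset.sum_congr rfl fun S hS => ?_
    have hSA := Finset.mem_powerset.1 hS
    have hiS : i ∉ S := fun h => hi (hSA h)
    rw [Finset.insert_sdiff_of_notMem _ hiS, Finset.prod_insert (by simp [hi])]
    ring

theorem subsetExp_add (p : ℕ → ℝ) (A : Finset ℕ) (f g : Finset ℕ → ℝ) :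
    subsetExp p A (fun S => f S + g S) = subsetExp p A f + subsetExp p A g := by
  simp only [subsetExp, mul_add, Finset.sum_add_distrib]

theorem subsetExp_const_mul (p : ℕ → ℝ) (A : Finset ℕ) (c : ℝ) (f : Finset ℕ → ℝ) :
    subsetExp p A (fun S => c * f S) = c * subsetExp p A f := by
  simp only [subsetExp, Finset.mul_sum]
  exact Finset.sum_congr rfl fun S _ => by ring

theorem subsetExp_sub (p : ℕ → ℝ) (A : Finset ℕ) (f g : Finset ℕ → ℝ) :
    subsetExp p A (fun S => f S - g S) = subsetExp p A f - subsetExp p A g := by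
  simp only [subsetExp, mul_sub, Finset.sum_sub_distrib]

theorem subsetExp_sum {ι : Type*} (p : ℕ → ℝ) (A : Finset ℕ) (s : Finset ι)
    (f : ι → Finset ℕ → ℝ) :
    subsetExp p A (fun S => ∑ j ∈ s, f j S) = ∑ j ∈ s, subsetExp p A (f j) := by
  simp only [subsetExp, Finset.mul_sum]
  exact Finset.sum_comm

theorem subsetExp_const (p : ℕ → ℝ) (A : Finset ℕ) (c : ℝ) :
    subsetExp p A (fun _ => c) = c := by
  induction A using Finset.induction_on with
  | empty => simp [subsetExp_empty]
  | insert i A hi ih =>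
    rw [subsetExp_insert p hi, ih]
    ring

theorem subsetExp_mono {p : ℕ → ℝ} (hp : ∀ i, p i ∈ Set.Icc (0 : ℝ) 1) {A : Finset ℕ}
    {f g : Finset ℕ → ℝ} (h : ∀ S ⊆ A, f S ≤ g S) : subsetExp p A f ≤ subsetExp p A g := by
  refine Finset.sum_le_sum fun S hS => mul_le_mul_of_nonneg_left (h S (Finset.mem_powerset.1 hS))
    (mul_nonneg (Finset.prod_nonneg fun i _ => (hp i).1)
      (Finset.prod_nonneg fun i _ => sub_nonneg.2 (hp i).2))

theorem subsetExp_prod (p : ℕ → ℝ) (A : Finset ℕ) (u v : ℕ → ℝ) :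
    subsetExp p A (fun S => (∏ i ∈ S, u i) * ∏ i ∈ A \ S, v i) =
      ∏ i ∈ A, (p i * u i + (1 - p i) * v i) := by
  rw [Finset.prod_add]
  refine Finset.sum_congr rfl fun S _ => ?_
  rw [Finset.prod_mul_distrib, Finset.prod_mul_distrib]
  ring

theorem marginExp_insert (p : ℕ → ℝ) {A : Finset ℕ} {i : ℕ} (hi : i ∉ A) (g : ℤ → ℝ) :
    marginExp p (insert i A) g =
      p i * marginExp p A (fun s => g (s + 1)) + (1 - p i) * marginExp p A (fun s => g (s - 1)) := by
  unfold marginExp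
  rw [subsetExp_insert p hi]
  congr 2
  · refine subsetExp_congr fun S hS => ?_
    have hiS : i ∉ S := fun h => hi (hS h)
    simp only [margin, Finset.card_insert_of_notMem hi, Finset.card_insert_of_notMem hiS]
    congr 1
    push_cast
    ring
  · refine subsetExp_congr fun S hS => ?_
    simp only [margin, Finset.card_insert_of_notMem hi]
    congr 1
    push_cast
    ring

theorem marginExp_mono {p : ℕ → ℝ} (hp : ∀ i, p i ∈ Set.Icc (0 : ℝ) 1) (A : Finset ℕ)
    {f g : ℤ → ℝ} (h : ∀ s, f s ≤ g s) : marginExp p A f ≤ marginExp p A g :=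
  subsetExp_mono hp fun _ _ => h _

theorem marginExp_nonneg {p : ℕ → ℝ} (hp : ∀ i, p i ∈ Set.Icc (0 : ℝ) 1) (A : Finset ℕ)
    {g : ℤ → ℝ} (h : ∀ s, 0 ≤ g s) : 0 ≤ marginExp p A g := by
  have := marginExp_mono hp A h
  rwa [marginExp, subsetExp_const] at this

theorem meanSign_le_one {p : ℕ → ℝ} (hp : ∀ i, p i ∈ Set.Icc (0 : ℝ) 1) (A : Finset ℕ) :
    meanSign p A ≤ 1 := by
  rw [← subsetExp_const p A 1]
  refine marginExp_mono (g := fun _ => 1) hp A fun s => ?_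
  rcases lt_trichotomy s 0 with h | h | h
  · rw [Int.sign_eq_neg_one_of_neg h]
    norm_num
  · rw [h]
    norm_num
  · rw [Int.sign_eq_one_of_pos h]
    norm_num

theorem marginExp_neg_le {p : ℕ → ℝ} (hp : ∀ i, p i ∈ Set.Icc (0 : ℝ) 1) (A : Finset ℕ) :
    marginExp p A (fun s => if s < 0 then 1 else 0) ≤ (1 - meanSign p A) / 2 := by
  have : (1 - meanSign p A) / 2 = marginExp p A (fun s => 1 / 2 * (1 - (s.sign : ℝ))) := by
    rw [marginExp, subsetExp_const_mul, subsetExp_sub, subsetExp_const, meanSign, marginExp]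
    ring
  rw [this]
  refine marginExp_mono hp A fun s => ?_
  rcases lt_trichotomy s 0 with h | h | h
  · rw [Int.sign_eq_neg_one_of_neg h, if_pos h]
    norm_num
  · rw [h]
    norm_num
  · rw [Int.sign_eq_one_of_pos h, if_neg h.not_gt]
    norm_num

/-- The correlation of the correctness of the voter `i` with a tied vote. -/
def tieCorrelation (p : ℕ → ℝ) (A : Finset ℕ) (i : ℕ) : ℝ :=
  subsetExp p A fun S => (if i ∈ S then 1 else -1) * if margin A S = 0 then 1 else 0

/-- A new vote affects the sign of the old margin s only for s in {-1, 0, 1}: from 0 it decides the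
vote, from ±1 it may produce a tie. -/
theorem meanSign_insert_sub (p : ℕ → ℝ) {A : Finset ℕ} {i : ℕ} (hi : i ∉ A) :
    meanSign p (insert i A) - meanSign p A = tieCorrelation p (insert i A) i +
      (2 * p i - 1) * marginExp p A (fun s => if s = 0 then 1 else 0) := by
  have h1 : tieCorrelation p (insert i A) i =
      p i * marginExp p A (fun s => if s = -1 then 1 else 0) -
        (1 - p i) * marginExp p A (fun s => if s = 1 then 1 else 0) := by
    rw [tieCorrelation, subsetExp_insert p hi, sub_eq_add_neg (p i * _), ← mul_neg]
    congr 2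
    · refine subsetExp_congr fun S hS => ?_
      have hiS : i ∉ S := fun h => hi (hS h)
      simp only [margin, Finset.card_insert_of_notMem hi, Finset.card_insert_of_notMem hiS,
        Finset.mem_insert_self, if_true, one_mul]
      congr 1
      push_cast
      apply propext
      constructor <;> intro h <;> linarith
    · rw [← neg_one_mul (marginExp p A _), marginExp, ← subsetExp_const_mul]
      refine subsetExp_congr fun S hS => ?_
      have hiS : i ∉ S := fun h => hi (hS h)
      simp only [margin, Finset.card_insert_of_notMem hi, if_neg hiS]
      congr 2
      push_cast
      apply propext
      constructor <;> intro h <;> linarith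
  rw [h1, meanSign, marginExp_insert p hi, meanSign]
  simp only [marginExp, ← subsetExp_const_mul, ← subsetExp_sub, ← subsetExp_add]
  refine subsetExp_congr fun S _ => ?_
  generalize margin A S = s
  rcases lt_trichotomy s 0 with h | h | h
  · rcases eq_or_lt_of_le (Int.le_sub_one_of_lt h) with h' | h'
    · have : s = -1 := by omega
      subst this
      norm_num [show Int.sign 2 = 1 from rfl]
    · rw [Int.sign_eq_neg_one_of_neg h, Int.sign_eq_neg_one_of_neg (by omega : s + 1 < 0),
        Int.sign_eq_neg_one_of_neg (by omega : s - 1 < 0), if_neg (by omega), if_neg (by omega),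
        if_neg (by omega)]
      push_cast
      ring
  · subst h
    norm_num
    ring
  · rcases eq_or_lt_of_le (Int.add_one_le_of_lt h) with h' | h'
    · have : s = 1 := by omega
      subst this
      norm_num [show Int.sign 2 = 1 from rfl]
    · rw [Int.sign_eq_one_of_pos h, Int.sign_eq_one_of_pos (by omega : 0 < s + 1),
        Int.sign_eq_one_of_pos (by omega : 0 < s - 1), if_neg (by omega), if_neg (by omega),
        if_neg (by omega)]
      push_cast
      ring

/-- The ±1 marks of correctness add up to the margin, which is zero on a tie. -/
theorem sum_tieCorrelation (p : ℕ → ℝ) (A : Finset ℕ) : ∑ i ∈ A, tieCorrelation p A i = 0 := by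
  simp only [tieCorrelation]
  rw [← subsetExp_sum]
  refine (subsetExp_congr fun S hS => ?_).trans (subsetExp_const p A 0)
  rw [← Finset.sum_mul]
  have h1 : ∑ i ∈ A, (if i ∈ S then (1 : ℝ) else -1) = (margin A S : ℝ) := by
    have h2 : ∀ i, (if i ∈ S then (1 : ℝ) else -1) = 2 * (if i ∈ S then 1 else 0) - 1 := by
      intro i
      split_ifs <;> norm_num
    simp only [h2]
    rw [Finset.sum_sub_distrib, ← Finset.mul_sum, Finset.sum_ite_mem,
      Finset.inter_eq_right.2 hS, margin]
    simp
  rw [h1]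
  by_cases h : margin A S = 0
  · simp [h]
  · simp [h]

/-- Only outcomes in which exactly one of i, j is correct contribute, and then the whole vote is
tied iff the vote of B is. -/
theorem tieCorrelation_sub (p : ℕ → ℝ) {B : Finset ℕ} {i j : ℕ} (hij : i ≠ j) (hi : i ∉ B)
    (hj : j ∉ B) :
    tieCorrelation p (insert i (insert j B)) i - tieCorrelation p (insert i (insert j B)) j =
      2 * (p i - p j) * marginExp p B (fun s => if s = 0 then 1 else 0) := by
  have hi' : i ∉ insert j B := by simp [hij, hi]
  rw [tieCorrelation, tieCorrelation, ← subsetExp_sub, subsetExp_insert p hi',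
    subsetExp_insert p hj, subsetExp_insert p hj]
  have e1 : subsetExp p B (fun S => ((if i ∈ insert i (insert j S) then (1 : ℝ) else -1) *
      if margin (insert i (insert j B)) (insert i (insert j S)) = 0 then 1 else 0) -
      (if j ∈ insert i (insert j S) then 1 else -1) *
      if margin (insert i (insert j B)) (insert i (insert j S)) = 0 then 1 else 0) = 0 := by
    rw [← subsetExp_const p B 0]
    refine subsetExp_congr fun S hS => ?_
    simp
  have e2 : subsetExp p B (fun S => ((if i ∈ S then (1 : ℝ) else -1) *
      if margin (insert i (insert j B)) S = 0 then 1 else 0) -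
      (if j ∈ S then 1 else -1) *
      if margin (insert i (insert j B)) S = 0 then 1 else 0) = 0 := by
    rw [← subsetExp_const p B 0]
    refine subsetExp_congr fun S hS => ?_
    rw [if_neg fun h => hi (hS h), if_neg fun h => hj (hS h), sub_self]
  have hm : ∀ k ∉ B, ∀ S ⊆ B, margin (insert i (insert j B)) (insert k S) = margin B S := by
    intro k hk S hS
    simp only [margin, Finset.card_insert_of_notMem hi', Finset.card_insert_of_notMem hj,
      Finset.card_insert_of_notMem fun h => hk (hS h)]
    push_cast
    ring
  have e3 : subsetExp p B (fun S => ((if i ∈ insert i S then (1 : ℝ) else -1) *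
      if margin (insert i (insert j B)) (insert i S) = 0 then 1 else 0) -
      (if j ∈ insert i S then 1 else -1) *
      if margin (insert i (insert j B)) (insert i S) = 0 then 1 else 0) =
      2 * marginExp p B (fun s => if s = 0 then 1 else 0) := by
    rw [marginExp, ← subsetExp_const_mul]
    refine subsetExp_congr fun S hS => ?_
    have hjS : j ∉ insert i S := by
      rw [Finset.mem_insert]
      rintro (h | h)
      exacts [hij h.symm, hj (hS h)]
    rw [hm i hi S hS, if_pos (Finset.mem_insert_self _ _), if_neg hjS]
    ring
  have e4 : subsetExp p B (fun S => ((if i ∈ insert j S then (1 : ℝ) else -1) *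
      if margin (insert i (insert j B)) (insert j S) = 0 then 1 else 0) -
      (if j ∈ insert j S then 1 else -1) *
      if margin (insert i (insert j B)) (insert j S) = 0 then 1 else 0) =
      -2 * marginExp p B (fun s => if s = 0 then 1 else 0) := by
    rw [marginExp, ← subsetExp_const_mul]
    refine subsetExp_congr fun S hS => ?_
    have hiS : i ∉ insert j S := by
      rw [Finset.mem_insert]
      rintro (h | h)
      exacts [hij h, hi (hS h)]
    rw [hm j hj S hS, if_pos (Finset.mem_insert_self _ _), if_neg hiS]
    ring
  rw [e1, e2, e3, e4]
  ring

/-- If the others tie and i is wrong, the vote is lost. -/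
theorem mul_marginExp_zero_le {p : ℕ → ℝ} (hp : ∀ i, p i ∈ Set.Icc (0 : ℝ) 1) {B : Finset ℕ}
    {i : ℕ} (hi : i ∉ B) :
    (1 - p i) * marginExp p B (fun s => if s = 0 then 1 else 0) ≤
      (1 - meanSign p (insert i B)) / 2 := by
  refine le_trans ?_ (marginExp_neg_le hp _)
  rw [marginExp_insert p hi]
  have h1 : marginExp p B (fun s => if s = 0 then 1 else 0) ≤
      marginExp p B (fun s => if s - 1 < 0 then 1 else 0) :=
    marginExp_mono hp B fun s => by split_ifs <;> first | omega | norm_num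
  have h2 : 0 ≤ marginExp p B (fun s => if s + 1 < 0 then 1 else 0) :=
    marginExp_nonneg hp B fun s => by split_ifs <;> norm_num
  have h3 := mul_le_mul_of_nonneg_left h1 (sub_nonneg.2 (hp i).2)
  have h4 := mul_nonneg (hp i).1 h2
  linarith

theorem mul_mul_marginExp_zero_le {p : ℕ → ℝ} (hp : ∀ i, p i ∈ Set.Icc (0 : ℝ) 1)
    {B : Finset ℕ} {i j : ℕ} (hij : i ≠ j) (hi : i ∉ B) (hj : j ∉ B) :
    (1 - p i) * (1 - p j) * marginExp p B (fun s => if s = 0 then 1 else 0) ≤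
      (1 - meanSign p (insert i (insert j B))) / 2 := by
  have hi' : i ∉ insert j B := by simp [hij, hi]
  refine le_trans ?_ (marginExp_neg_le hp _)
  rw [marginExp_insert p hi', marginExp_insert p hj (fun s => if s - 1 < 0 then 1 else 0)]
  have h1 : marginExp p B (fun s => if s = 0 then 1 else 0) ≤
      marginExp p B (fun s => if s - 1 - 1 < 0 then 1 else 0) :=
    marginExp_mono hp B fun s => by split_ifs <;> first | omega | norm_num
  have h2 : 0 ≤ marginExp p (insert j B) (fun s => if s + 1 < 0 then 1 else 0) :=
    marginExp_nonneg hp _ fun s => by split_ifs <;> norm_num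
  have h5 : 0 ≤ marginExp p B (fun s => if s + 1 - 1 < 0 then 1 else 0) :=
    marginExp_nonneg hp _ fun s => by split_ifs <;> norm_num
  have hqi := sub_nonneg.2 (hp i).2
  have hqj := sub_nonneg.2 (hp j).2
  have h3 := mul_le_mul_of_nonneg_left (mul_le_mul_of_nonneg_left h1 hqj) hqi
  have h4 := mul_nonneg (hp i).1 h2
  have h6 := mul_nonneg hqi (mul_nonneg (hp j).1 h5)
  linarith

/-- Removing one voter changes the mean sign of the margin by a multiple of the probability that
the vote is wrong; the factor is small if the competences are close to `1 / 2`. -/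
theorem abs_meanSign_erase_sub_le {p : ℕ → ℝ} {γ : ℝ} (hγ : 0 < γ)
    (hp : ∀ i, p i ∈ Set.Ioo γ (1 - γ)) {A : Finset ℕ} {i : ℕ} (hi : i ∈ A) :
    |meanSign p (A.erase i) - meanSign p A| ≤ (1 - meanSign p A) / γ ^ 2 *
      (|2 * p i - 1| + (∑ j ∈ A, |2 * p j - 1|) / A.card) := by
  have hp' : ∀ i, p i ∈ Set.Icc (0 : ℝ) 1 :=
    fun i => ⟨by linarith [(hp i).1], by linarith [(hp i).2]⟩
  have hγ1 : γ ≤ 1 := by linarith [(hp 0).1, (hp 0).2]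
  set π := (1 - meanSign p A) / 2 / γ ^ 2 with hπ
  have hloss : 0 ≤ (1 - meanSign p A) / 2 := by linarith [meanSign_le_one hp' A]
  have hπ0 : 0 ≤ π := by positivity
  have hcard : (0 : ℝ) < A.card := by exact_mod_cast Finset.card_pos.2 ⟨i, hi⟩
  have hP : ∀ B : Finset ℕ, 0 ≤ marginExp p B (fun s => if s = 0 then 1 else 0) := fun B =>
    marginExp_nonneg hp' B fun s => by split_ifs <;> norm_num
  have hsingle : marginExp p (A.erase i) (fun s => if s = 0 then 1 else 0) ≤ π := by
    have := mul_marginExp_zero_le hp' (Finset.notMem_erase i A)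
    rw [Finset.insert_erase hi] at this
    rw [hπ, le_div_iff₀ (by positivity)]
    refine le_trans ?_ this
    rw [mul_comm]
    refine mul_le_mul_of_nonneg_right ?_ (hP _)
    nlinarith [(hp i).2]
  have hpair : ∀ j ∈ A, |tieCorrelation p A i - tieCorrelation p A j| ≤
      π * (|2 * p i - 1| + |2 * p j - 1|) := by
    intro j hj
    rcases eq_or_ne i j with rfl | hij
    · rw [sub_self, abs_zero]
      positivity
    have hiB : i ∉ (A.erase i).erase j := by simp
    have hjB : j ∉ (A.erase i).erase j := by simp
    have hA : insert i (insert j ((A.erase i).erase j)) = A := by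
      rw [Finset.insert_erase (Finset.mem_erase.2 ⟨hij.symm, hj⟩), Finset.insert_erase hi]
    have h1 := tieCorrelation_sub p hij hiB hjB
    have h2 := mul_mul_marginExp_zero_le hp' hij hiB hjB
    rw [hA] at h1 h2
    have h3 : marginExp p ((A.erase i).erase j) (fun s => if s = 0 then 1 else 0) ≤ π := by
      rw [hπ, le_div_iff₀ (by positivity), mul_comm]
      refine le_trans (mul_le_mul_of_nonneg_right ?_ (hP _)) h2
      rw [sq]
      exact mul_le_mul (by linarith [(hp i).2]) (by linarith [(hp j).2]) hγ.le
        (by linarith [(hp i).2])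
    rw [h1, abs_mul, abs_of_nonneg (hP _), mul_comm]
    refine mul_le_mul h3 ?_ (abs_nonneg _) hπ0
    rw [show 2 * (p i - p j) = (2 * p i - 1) - (2 * p j - 1) by ring]
    exact abs_sub _ _
  have hcorr : |tieCorrelation p A i| ≤
      π * (|2 * p i - 1| + (∑ j ∈ A, |2 * p j - 1|) / A.card) := by
    -- As the correlations sum to zero, each is the average of its differences from the others; this
    -- is where the mean of |2 p j - 1| enters.
    have h1 : A.card * tieCorrelation p A i =
        ∑ j ∈ A, (tieCorrelation p A i - tieCorrelation p A j) := by
      rw [Finset.sum_sub_distrib, sum_tieCorrelation]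
      simp
    have h2 : A.card * |tieCorrelation p A i| ≤
        ∑ j ∈ A, π * (|2 * p i - 1| + |2 * p j - 1|) := by
      have h3 : A.card * |tieCorrelation p A i| = |A.card * tieCorrelation p A i| := by
        rw [abs_mul, abs_of_pos hcard]
      rw [h3, h1]
      exact (Finset.abs_sum_le_sum_abs _ _).trans (Finset.sum_le_sum hpair)
    rw [← Finset.mul_sum, Finset.sum_add_distrib, Finset.sum_const, nsmul_eq_mul] at h2
    refine le_of_mul_le_mul_left (h2.trans (le_of_eq ?_)) hcard
    field_simp
  have h := meanSign_insert_sub p (Finset.notMem_erase i A)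
  rw [Finset.insert_erase hi] at h
  rw [abs_sub_comm, h]
  have h1 : |(2 * p i - 1) * marginExp p (A.erase i) (fun s => if s = 0 then 1 else 0)| ≤
      |2 * p i - 1| * π := by
    rw [abs_mul, abs_of_nonneg (hP _)]
    exact mul_le_mul_of_nonneg_left hsingle (abs_nonneg _)
  have h2 : 0 ≤ π * ((∑ j ∈ A, |2 * p j - 1|) / A.card) := by positivity
  have h3 : (1 - meanSign p A) / γ ^ 2 = 2 * π := by rw [hπ]; ring
  rw [h3]
  have := abs_add_le (tieCorrelation p A i)
    ((2 * p i - 1) * marginExp p (A.erase i) (fun s => if s = 0 then 1 else 0))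
  linarith

end

/-! ### Probabilities in the opinion model and concentration of frequencies. -/

noncomputable section

section Model

variable {Ω : Type*} [MeasurableSpace Ω] {μ : Measure Ω}
  {p : ℕ → ℝ} {Y : ℕ → Ω → ℝ} {X : ℕ → ℕ → Ω → ℝ}

theorem measurableSet_filter_eq (h : IsOpinionModel μ p Y X) (t : ℕ) (A : Finset ℕ) (y : ℝ)
    (Q : Finset ℕ → Prop) :
    MeasurableSet {ω | Q (A.filter fun i => X i t ω = y)} := by
  classical
  have : {ω | Q (A.filter fun i => X i t ω = y)} =
      ⋃ S ∈ A.powerset.filter Q, ⋂ i ∈ A, {ω | X i t ω = y ↔ i ∈ S} := by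
    ext ω
    simp only [Set.mem_iUnion, Set.mem_iInter, Finset.mem_filter, Finset.mem_powerset,
      Set.mem_ofPred_eq, exists_prop]
    constructor
    · intro hQ
      refine ⟨A.filter fun i => X i t ω = y, ⟨Finset.filter_subset _ _, hQ⟩, fun i hi => ?_⟩
      simp [hi]
    · rintro ⟨S, ⟨hSA, hQ⟩, hS⟩
      convert hQ
      ext i
      rw [Finset.mem_filter]
      exact ⟨fun ⟨hi, hx⟩ => (hS i hi).1 hx, fun hi => ⟨hSA hi, (hS i (hSA hi)).2 hi⟩⟩
  rw [this]
  refine Finset.measurableSet_biUnion _ fun S _ => Finset.measurableSet_biInter _ fun i _ => ?_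
  have hm : MeasurableSet {ω | X i t ω = y} := h.measurable_opinion i t (measurableSet_singleton y)
  by_cases hi : i ∈ S
  · simpa [hi] using hm
  · simp only [hi, iff_false]
    exact hm.compl

open Classical in
/-- Given the state of a task, the set of correct voters is a random set of independent
elements. -/
theorem cond_real_filter_eq [IsProbabilityMeasure μ] (h : IsOpinionModel μ p Y X) (t : ℕ) (A : Finset ℕ) {y : ℝ}
    (hy : y = 1 ∨ y = -1) (Q : Finset ℕ → Prop) :
    (μ[|{ω | Y t ω = y}]).real {ω | Q (A.filter fun i => X i t ω = y)} =
      subsetExp p A fun S => if Q S then 1 else 0 := by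
  have hYm : MeasurableSet {ω | Y t ω = y} := h.measurable_state t (measurableSet_singleton y)
  have hY0 : μ {ω | Y t ω = y} ≠ 0 := by
    intro h0
    have := h.uniform_prior t y hy
    rw [measureReal_def, h0] at this
    norm_num at this
  set ν := μ[|{ω | Y t ω = y}] with hν
  have : IsProbabilityMeasure ν := cond_isProbabilityMeasure hY0
  have hXm : ∀ i, MeasurableSet {ω | X i t ω = y} :=
    fun i => h.measurable_opinion i t (measurableSet_singleton y)
  have hsingle : ∀ S ⊆ A, ν.real {ω | (A.filter fun i => X i t ω = y) = S} =
      (∏ i ∈ S, p i) * ∏ i ∈ A \ S, (1 - p i) := by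
    intro S hS
    have hset : {ω | (A.filter fun i => X i t ω = y) = S} =
        ⋂ i ∈ A, (fun ω => X i t ω) ⁻¹' (if i ∈ S then {y} else {y}ᶜ) := by
      ext ω
      simp only [Set.mem_iInter, Set.mem_ofPred_eq, Set.mem_preimage]
      constructor
      · rintro rfl i hi
        by_cases hx : X i t ω = y <;> simp [hi, hx]
      · intro hx
        ext i
        rw [Finset.mem_filter]
        constructor
        · rintro ⟨hi, hxi⟩
          by_contra hiS
          have := hx i hi
          simp [hiS, hxi] at this
        · intro hiS
          have := hx i (hS hiS)
          simp only [hiS, if_true] at this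
          exact ⟨hS hiS, this⟩
    rw [measureReal_def, hset, (h.opinions_condIndep t y hy).measure_inter_preimage_eq_mul A
      fun i _ => by split_ifs <;> measurability, ENNReal.toReal_prod,
      ← Finset.prod_sdiff hS, mul_comm]
    congr 1
    · refine Finset.prod_congr rfl fun i hi => ?_
      rw [if_pos hi]
      exact h.competence i t y hy
    · refine Finset.prod_congr rfl fun i hi => ?_
      rw [if_neg (Finset.mem_sdiff.1 hi).2, Set.preimage_compl]
      have h1 := h.competence i t y hy
      have h2 := probReal_compl_eq_one_sub (μ := ν) (hXm i)
      rw [← hν] at h1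
      rw [h1] at h2
      exact h2
  have hunion : {ω | Q (A.filter fun i => X i t ω = y)} =
      ⋃ S ∈ A.powerset.filter Q, {ω | (A.filter fun i => X i t ω = y) = S} := by
    ext ω
    simp
  rw [hunion, measureReal_biUnion_finset]
  · rw [Finset.sum_filter, subsetExp]
    refine Finset.sum_congr rfl fun S hS => ?_
    rw [hsingle S (Finset.mem_powerset.1 hS)]
    simp
  · intro S _ S' _ hne
    rw [Function.onFun, Set.disjoint_left]
    intro ω hω hω'
    exact hne (hω.symm.trans hω')
  · intro S _
    exact measurableSet_filter_eq h t A y fun S' => S' = S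

open Classical in
-- Reduces an event determined by the state and the set of correct voters to finite sums, by
-- conditioning on the state.
theorem real_eq_subsetExp [IsProbabilityMeasure μ] (h : IsOpinionModel μ p Y X) (t : ℕ) (A : Finset ℕ)
    {E : Set Ω} (hE : MeasurableSet E) (Q : ℝ → Finset ℕ → Prop)
    (hQ : ∀ ω, ω ∈ E ↔ Q (Y t ω) (A.filter fun i => X i t ω = Y t ω)) :
    μ.real E = 1 / 2 * (subsetExp p A fun S => if Q 1 S then 1 else 0) +
      1 / 2 * (subsetExp p A fun S => if Q (-1) S then 1 else 0) := by
  have hYm : ∀ y, MeasurableSet {ω | Y t ω = y} :=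
    fun y => h.measurable_state t (measurableSet_singleton y)
  have hpart : ∀ y : ℝ, y = 1 ∨ y = -1 → μ.real ({ω | Y t ω = y} ∩ E) =
      1 / 2 * subsetExp p A fun S => if Q y S then 1 else 0 := by
    intro y hy
    rw [← cond_real_filter_eq h t A hy, ← h.uniform_prior t y hy, measureReal_def, measureReal_def,
      measureReal_def, ← ENNReal.toReal_mul, mul_comm, cond_mul_eq_inter (hYm y)]
    congr 2
    ext ω
    simp only [Set.mem_inter_iff, Set.mem_ofPred_eq]
    constructor
    · rintro ⟨rfl, hω⟩
      exact ⟨rfl, (hQ ω).1 hω⟩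
    · rintro ⟨rfl, hω⟩
      exact ⟨rfl, (hQ ω).2 hω⟩
  have hE2 : E = ({ω | Y t ω = 1} ∩ E) ∪ ({ω | Y t ω = -1} ∩ E) := by
    ext ω
    have := h.state_values t ω
    simp only [Set.mem_union, Set.mem_inter_iff, Set.mem_ofPred_eq]
    tauto
  rw [← hpart 1 (Or.inl rfl), ← hpart (-1) (Or.inr rfl)]
  nth_rewrite 1 [hE2]
  refine measureReal_union ?_ ((hYm _).inter hE)
  rw [Set.disjoint_left]
  rintro ω ⟨h1, _⟩ ⟨h2, _⟩
  have : (1 : ℝ) = -1 := h1.symm.trans h2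
  norm_num at this

theorem sum_eq_mul_margin (A : Finset ℕ) (x : ℕ → ℝ) {y : ℝ} (hy : y = 1 ∨ y = -1)
    (hx : ∀ i, x i = 1 ∨ x i = -1) :
    ∑ i ∈ A, x i = y * (margin A (A.filter fun i => x i = y) : ℝ) := by
  have h1 : ∀ i, x i = y * (2 * (if x i = y then 1 else 0) - 1) := by
    intro i
    rcases hy with rfl | rfl <;> rcases hx i with h | h <;> rw [h] <;> norm_num
  rw [Finset.sum_congr rfl fun i _ => h1 i, ← Finset.mul_sum, Finset.sum_sub_distrib,
    ← Finset.mul_sum, ← Finset.sum_filter, margin]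
  simp

theorem majorityVote_eq_iff (tie : Finset ℕ → ℝ)
    (A : Finset ℕ) (x : ℕ → ℝ) {y : ℝ} (hy : y = 1 ∨ y = -1) (hx : ∀ i, x i = 1 ∨ x i = -1) :
    majorityVote tie A x = y ↔ 0 < margin A (A.filter fun i => x i = y) ∨
      (margin A (A.filter fun i => x i = y) = 0 ∧ tie A = y) := by
  rw [majorityVote, sum_eq_mul_margin A x hy hx, signWithTie]
  generalize margin A (A.filter fun i => x i = y) = s
  rcases lt_trichotomy s 0 with h | h | h
  · have hs : (s : ℝ) < 0 := by exact_mod_cast h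
    rcases hy with rfl | rfl
    · rw [if_neg (by linarith), if_pos (by linarith)]
      constructor
      · intro h'
        norm_num at h'
      · rintro (h' | h') <;> omega
    · rw [if_pos (by linarith)]
      constructor
      · intro h'
        norm_num at h'
      · rintro (h' | h') <;> omega
  · subst h
    simp
  · have hs : (0 : ℝ) < s := by exact_mod_cast h
    rcases hy with rfl | rfl
    · rw [if_pos (by linarith)]
      simp [h]
    · rw [if_neg (by linarith), if_pos (by linarith)]
      simp [h]

theorem majorityVote_values {tie : Finset ℕ → ℝ} (htie : ∀ A, tie A = 1 ∨ tie A = -1)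
    (A : Finset ℕ) (x : ℕ → ℝ) : majorityVote tie A x = 1 ∨ majorityVote tie A x = -1 := by
  rw [majorityVote, signWithTie]
  split_ifs
  exacts [Or.inl rfl, Or.inr rfl, htie A]

theorem measurable_signWithTie (tie : ℝ) : Measurable (signWithTie tie) := by
  refine Measurable.ite measurableSet_Ioi measurable_const ?_
  exact Measurable.ite measurableSet_Iio measurable_const measurable_const

theorem measurable_majorityVote (h : IsOpinionModel μ p Y X) (tie : Finset ℕ → ℝ) (A : Finset ℕ)
    (t : ℕ) : Measurable fun ω => majorityVote tie A fun i => X i t ω :=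
  (measurable_signWithTie _).comp (Finset.measurable_sum _ fun i _ => h.measurable_opinion i t)

/-- The event, in terms of the margin, that the majority vote is correct. -/
def MajorityCorrect (tie y : ℝ) (s : ℤ) : Prop := 0 < s ∨ (s = 0 ∧ tie = y)

open Classical in
-- The fixed value of a tie is right for exactly one of the two states, so summed over the states a
-- tie counts 1, which is 1 + sign 0.
theorem marginExp_majorityCorrect (p : ℕ → ℝ) (A : Finset ℕ) {tie : ℝ}
    (htie : tie = 1 ∨ tie = -1) :
    marginExp p A (fun s => if MajorityCorrect tie 1 s then 1 else 0) +
      marginExp p A (fun s => if MajorityCorrect tie (-1) s then 1 else 0) = 1 + meanSign p A := by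
  rw [meanSign, marginExp, marginExp, marginExp, ← subsetExp_add]
  conv_rhs => rw [← subsetExp_const p A 1, ← subsetExp_add]
  refine subsetExp_congr fun S _ => ?_
  generalize margin A S = s
  rcases lt_trichotomy s 0 with h | h | h
  · simp [MajorityCorrect, h.not_gt, h.ne, Int.sign_eq_neg_one_of_neg h]
  · subst h
    rcases htie with rfl | rfl <;> norm_num [MajorityCorrect]
  · simp [MajorityCorrect, h, Int.sign_eq_one_of_pos h]

/-- The accuracy of the majority vote does not depend on the tie-breaking rule. -/
theorem majorityAccuracy_eq [IsProbabilityMeasure μ] (h : IsOpinionModel μ p Y X) {tie : ℕ → Finset ℕ → ℝ}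
    (htie : ∀ t A, tie t A = 1 ∨ tie t A = -1) (n : ℕ) :
    majorityAccuracy μ Y X tie n = (1 + meanSign p (Finset.range n)) / 2 := by
  classical
  rw [majorityAccuracy, real_eq_subsetExp h 0 (Finset.range n)
    (measurableSet_eq_fun (measurable_majorityVote h _ _ 0) (h.measurable_state 0))
    (fun y S => MajorityCorrect (tie 0 (Finset.range n)) y (margin (Finset.range n) S))
    fun ω => majorityVote_eq_iff (tie 0) _ _ (h.state_values 0 ω)
      fun i => h.opinion_values i 0 ω,
    ← marginExp_majorityCorrect p _ (htie 0 (Finset.range n))]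
  simp only [marginExp]
  ring

/-- Agreement means that expert and vote are both right or both wrong. Given the state these are
independent, and averaging over the states removes the tie rule. -/
theorem real_agreement_eq [IsProbabilityMeasure μ] (h : IsOpinionModel μ p Y X) {tie : Finset ℕ → ℝ}
    (htie : ∀ A, tie A = 1 ∨ tie A = -1) {B : Finset ℕ} {i : ℕ} (hi : i ∉ B) (t : ℕ) :
    μ.real {ω | X i t ω = majorityVote tie B fun j => X j t ω} =
      1 / 2 + (p i - 1 / 2) * meanSign p B := by
  classical
  have hE : MeasurableSet {ω | X i t ω = majorityVote tie B fun j => X j t ω} :=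
    measurableSet_eq_fun (h.measurable_opinion i t) (measurable_majorityVote h _ _ t)
  obtain ⟨Q, hQ⟩ : ∃ Q : ℝ → Finset ℕ → Prop, ∀ y S, Q y S ↔
      (i ∈ S ↔ MajorityCorrect (tie B) y (margin B (S.erase i))) := ⟨_, fun _ _ => Iff.rfl⟩
  rw [real_eq_subsetExp h t (insert i B) hE Q]
  · have key : ∀ y : ℝ, subsetExp p (insert i B) (fun S =>
        if Q y S then 1 else 0) =
        p i * marginExp p B (fun s => if MajorityCorrect (tie B) y s then 1 else 0) +
        (1 - p i) * (1 - marginExp p B (fun s => if MajorityCorrect (tie B) y s then 1 else 0)) := by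
      intro y
      rw [subsetExp_insert p hi]
      congr 2
      · refine subsetExp_congr fun S hS => ?_
        have hiS : i ∉ S := fun h => hi (hS h)
        simp [hQ, Finset.erase_insert hiS]
      · nth_rewrite 2 [← subsetExp_const p B 1]
        rw [marginExp, ← subsetExp_sub]
        refine subsetExp_congr fun S hS => ?_
        have hiS : i ∉ S := fun h => hi (hS h)
        simp only [hQ, hiS, Finset.erase_eq_of_notMem hiS, false_iff]
        split_ifs <;> simp_all
    rw [key, key]
    have := marginExp_majorityCorrect p B (htie B)
    linear_combination (p i - 1 / 2) * this
  · intro ω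
    have hfil : ((insert i B).filter fun j => X j t ω = Y t ω).erase i =
        B.filter fun j => X j t ω = Y t ω := by
      ext j
      simp only [Finset.mem_erase, Finset.mem_filter, Finset.mem_insert]
      constructor
      · rintro ⟨h1, h2 | h2, h3⟩
        exacts [absurd h2 h1, ⟨h2, h3⟩]
      · rintro ⟨h1, h2⟩
        exact ⟨fun hji => hi (hji ▸ h1), Or.inr h1, h2⟩
    rw [hQ, hfil, MajorityCorrect, ← majorityVote_eq_iff tie B _ (h.state_values t ω)
      fun i => h.opinion_values i t ω]
    have h1 := majorityVote_values htie B fun j => X j t ω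
    have h2 := h.opinion_values i t ω
    have h3 := h.state_values t ω
    have hne : (1 : ℝ) ≠ -1 := by norm_num
    have hne' : (-1 : ℝ) ≠ 1 := by norm_num
    simp only [Set.mem_ofPred_eq, Finset.mem_filter, Finset.mem_insert_self, true_and]
    rcases h1 with h1 | h1 <;> rcases h2 with h2 | h2 <;> rcases h3 with h3 | h3 <;>
      simp [h1, h2, h3, hne, hne']

/-- Chernoff's bound for a weighted vote with constant weights. -/
theorem real_weighted_sum_le [IsProbabilityMeasure μ] (h : IsOpinionModel μ p Y X) (hp : ∀ i, p i ∈ Set.Icc (0 : ℝ) 1)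
    (A : Finset ℕ) (w : ℕ → ℝ) (K : ℝ) {l : ℝ} (hl : 0 ≤ l) (t : ℕ) :
    μ.real {ω | (∑ i ∈ A, X i t ω * w i) * Y t ω ≤ K} ≤
      Real.exp (l * K) * ∏ i ∈ A, (p i * Real.exp (-(l * w i)) + (1 - p i) * Real.exp (l * w i)) := by
  classical
  have hE : MeasurableSet {ω | (∑ i ∈ A, X i t ω * w i) * Y t ω ≤ K} :=
    measurableSet_le ((Finset.measurable_sum _ fun i _ =>
      (h.measurable_opinion i t).mul_const _).mul (h.measurable_state t)) measurable_const
  have hY2 : ∀ ω, Y t ω * Y t ω = 1 := fun ω => by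
    rcases h.state_values t ω with h1 | h1 <;> rw [h1] <;> norm_num
  rw [real_eq_subsetExp h t A hE
    (fun _ S => ∑ i ∈ S, w i + ∑ i ∈ A \ S, -w i ≤ K)]
  · have hle : subsetExp p A (fun S => if ∑ i ∈ S, w i + ∑ i ∈ A \ S, -w i ≤ K then 1 else 0) ≤
        Real.exp (l * K) *
          ∏ i ∈ A, (p i * Real.exp (-(l * w i)) + (1 - p i) * Real.exp (l * w i)) := by
      rw [← subsetExp_prod, ← subsetExp_const_mul]
      refine subsetExp_mono hp fun S _ => ?_
      rw [← Real.exp_sum, ← Real.exp_sum, ← Real.exp_add, ← Real.exp_add]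
      split_ifs with hK
      · rw [Real.one_le_exp_iff]
        have := mul_le_mul_of_nonneg_left hK hl
        rw [mul_add, Finset.mul_sum, Finset.mul_sum] at this
        simp only [mul_neg, Finset.sum_neg_distrib] at this ⊢
        linarith
      · exact (Real.exp_pos _).le
    linarith
  · intro ω
    have : (∑ i ∈ A, X i t ω * w i) * Y t ω =
        ∑ i ∈ A.filter (fun i => X i t ω = Y t ω), w i +
          ∑ i ∈ A \ A.filter (fun i => X i t ω = Y t ω), -w i := by
      rw [Finset.sum_mul, ← Finset.sum_sdiff (Finset.filter_subset (fun i => X i t ω = Y t ω) A),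
        add_comm]
      congr 1
      · refine Finset.sum_congr rfl fun i hi => ?_
        rw [(Finset.mem_filter.1 hi).2]
        linear_combination w i * hY2 ω
      · refine Finset.sum_congr rfl fun i hi => ?_
        have hne : X i t ω ≠ Y t ω := by
          intro heq
          rw [Finset.mem_sdiff, Finset.mem_filter] at hi
          exact hi.2 ⟨hi.1, heq⟩
        have hneg : X i t ω = - Y t ω := by
          rcases h.opinion_values i t ω with h1 | h1 <;> rcases h.state_values t ω with h2 | h2 <;>
            first
            | exact absurd (h1.trans h2.symm) hne
            | rw [h1, h2, neg_neg]
            | rw [h1, h2]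
        rw [hneg]
        linear_combination -w i * hY2 ω
    rw [Set.mem_ofPred_eq, this]

end Model

/-- A two-sided multiplicative Chernoff bound for the frequency of independent events. -/
theorem bernoulli_average_tail {Ω : Type*} [MeasurableSpace Ω] {μ : Measure Ω}
    [IsProbabilityMeasure μ] {E : ℕ → Set Ω} (hE : ∀ t, MeasurableSet (E t))
    (hind : iIndepFun (fun t => (E t).indicator (fun _ => (1 : ℝ))) μ) {q : ℝ}
    (hq : q ∈ Set.Icc (0 : ℝ) 1) (hEq : ∀ t, μ.real (E t) = q) {T : ℕ} (hT : 1 ≤ T) {r : ℝ}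
    (hr : 0 ≤ r) (hr' : r ≤ 22 / 25) :
    μ.real {ω | r * min q (1 - q) ≤
      |1 / (T : ℝ) * ∑ t ∈ Finset.range T, (E t).indicator (fun _ => (1 : ℝ)) ω - q|} ≤
      2 * Real.exp (-(T * min q (1 - q) * (3 / 8 * r ^ 2))) := by
  set m := min q (1 - q) with hm
  have hm0 : 0 ≤ m := le_min hq.1 (sub_nonneg.2 hq.2)
  have hT' : (0 : ℝ) < T := by exact_mod_cast hT
  set Z : ℕ → Ω → ℝ := fun t ω => (E t).indicator (fun _ => (1 : ℝ)) ω - q with hZ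
  have hZm : ∀ t, Measurable (Z t) := fun t =>
    (measurable_const.indicator (hE t)).sub_const q
  have hZind : iIndepFun Z μ :=
    hind.comp (fun _ x => x - q) fun _ => measurable_id.sub_const q
  have hexp : ∀ l t ω, Real.exp (l * Z t ω) = (E t).indicator (fun _ => (1 : ℝ)) ω *
      (Real.exp (l * (1 - q)) - Real.exp (l * (0 - q))) + Real.exp (l * (0 - q)) := by
    intro l t ω
    by_cases hω : ω ∈ E t <;> simp [hZ, hω]
  have hint1 : ∀ t, Integrable ((E t).indicator (fun _ => (1 : ℝ))) μ := fun t =>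
    (integrable_const 1).indicator (hE t)
  have hint : ∀ l t, Integrable (fun ω => Real.exp (l * Z t ω)) μ := by
    intro l t
    simp only [hexp]
    exact ((hint1 t).mul_const _).add (integrable_const _)
  have hmgf : ∀ l t, |l| ≤ 1 → mgf (Z t) μ l ≤ Real.exp (m * (l ^ 2 / 2 + 2 / 9 * |l| ^ 3)) := by
    intro l t hl
    refine le_trans (le_of_eq ?_) (bernoulli_mgf_le_min hq hl)
    rw [mgf]
    simp only [hexp]
    rw [integral_add ((hint1 t).mul_const _) (integrable_const _), integral_mul_const,
      integral_indicator (hE t), integral_const, integral_const]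
    simp only [measureReal_restrict_apply_univ, hEq, smul_eq_mul, probReal_univ]
    ring
  have hmgf_sum : ∀ l, |l| ≤ 1 → mgf (∑ t ∈ Finset.range T, Z t) μ l ≤
      Real.exp (T * (m * (l ^ 2 / 2 + 2 / 9 * |l| ^ 3))) := by
    intro l hl
    rw [hZind.mgf_sum hZm]
    refine (Finset.prod_le_prod (fun t _ => mgf_nonneg) fun t _ => hmgf l t hl).trans ?_
    rw [Finset.prod_const, Finset.card_range, ← Real.exp_nat_mul]
  have hints : ∀ l, Integrable (fun ω => Real.exp (l * (∑ t ∈ Finset.range T, Z t) ω)) μ :=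
    fun l => hZind.integrable_exp_mul_sum hZm fun t _ => hint l t
  -- The tilt (4/5) r gives the coefficient -4/5 + 8/25 + (2/9)(64/125)(22/25) of r², just below
  -- -3/8.
  have hexponent : -(4 / 5 * r) * (T * (r * m)) +
      T * (m * ((4 / 5 * r) ^ 2 / 2 + 2 / 9 * (4 / 5 * r) ^ 3)) ≤
      -(T * m * (3 / 8 * r ^ 2)) := by
    have h1 : 0 ≤ T * m * r ^ 2 := by positivity
    have h2 : T * m * r ^ 2 * r ≤ T * m * r ^ 2 * (22 / 25) := mul_le_mul_of_nonneg_left hr' h1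
    linarith
  have habs : |4 / 5 * r| = 4 / 5 * r := abs_of_nonneg (by positivity)
  have hl1 : |4 / 5 * r| ≤ 1 := by rw [habs]; linarith
  have hup : μ.real {ω | T * (r * m) ≤ (∑ t ∈ Finset.range T, Z t) ω} ≤
      Real.exp (-(T * m * (3 / 8 * r ^ 2))) := by
    refine (measure_ge_le_exp_mul_mgf _ (by positivity : 0 ≤ 4 / 5 * r) (hints _)).trans ?_
    refine (mul_le_mul_of_nonneg_left (hmgf_sum _ hl1) (Real.exp_pos _).le).trans ?_
    rw [← Real.exp_add, Real.exp_le_exp, habs]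
    exact hexponent
  have hdown : μ.real {ω | (∑ t ∈ Finset.range T, Z t) ω ≤ -(T * (r * m))} ≤
      Real.exp (-(T * m * (3 / 8 * r ^ 2))) := by
    refine (measure_le_le_exp_mul_mgf _ (by linarith : -(4 / 5 * r) ≤ 0) (hints _)).trans ?_
    refine (mul_le_mul_of_nonneg_left (hmgf_sum _ (by rwa [abs_neg])) (Real.exp_pos _).le).trans ?_
    rw [← Real.exp_add, Real.exp_le_exp, abs_neg, habs]
    linarith
  have hsub : {ω | r * m ≤
      |1 / (T : ℝ) * ∑ t ∈ Finset.range T, (E t).indicator (fun _ => (1 : ℝ)) ω - q|} ⊆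
      {ω | T * (r * m) ≤ (∑ t ∈ Finset.range T, Z t) ω} ∪
        {ω | (∑ t ∈ Finset.range T, Z t) ω ≤ -(T * (r * m))} := by
    intro ω hω
    have e : (∑ t ∈ Finset.range T, Z t) ω =
        T * (1 / (T : ℝ) * ∑ t ∈ Finset.range T, (E t).indicator (fun _ => (1 : ℝ)) ω - q) := by
      simp only [hZ, Finset.sum_apply, Finset.sum_sub_distrib, Finset.sum_const,
        Finset.card_range, nsmul_eq_mul]
      field_simp
    rw [Set.mem_union, Set.mem_ofPred_eq, Set.mem_ofPred_eq, e]
    rcases le_abs.1 (Set.mem_ofPred_eq ▸ hω) with h | h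
    · exact Or.inl (mul_le_mul_of_nonneg_left h hT'.le)
    · right
      have := mul_le_mul_of_nonneg_left h hT'.le
      linarith
  refine (measureReal_mono hsub).trans ((measureReal_union_le _ _).trans ?_)
  linarith

end

/-! ### Pseudo competences, their weights and their estimation. -/

noncomputable section

/-- Both x / y and (1 - x) / (1 - y) lie in [1 - r, 1 + r]. In particular 0 < x < 1, so the
replacement weights never occur. -/
theorem abs_logOdds_sub_le {x y r : ℝ} (hr : 0 ≤ r) (hr1 : r < 1) (hy : y ∈ Set.Ioo (0 : ℝ) 1)
    (hxy : |x - y| < r * min y (1 - y)) (w₀ w₁ : ℝ) :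
    |logOddsWeight w₀ w₁ x - Real.log (y / (1 - y))| ≤ Real.log ((1 + r) / (1 - r)) := by
  obtain ⟨hy0, hy1⟩ := hy
  obtain ⟨hl, hu⟩ := abs_lt.1 hxy
  have h1 : r * min y (1 - y) ≤ r * y := mul_le_mul_of_nonneg_left (min_le_left _ _) hr
  have h2 : r * min y (1 - y) ≤ r * (1 - y) := mul_le_mul_of_nonneg_left (min_le_right _ _) hr
  have hy1' : 0 < 1 - y := sub_pos.2 hy1
  have hr1' : 0 < 1 - r := sub_pos.2 hr1
  have e1 : (1 - r) * y ≤ x := by linarith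
  have e2 : x ≤ (1 + r) * y := by linarith
  have e3 : (1 - r) * (1 - y) ≤ 1 - x := by linarith
  have e4 : 1 - x ≤ (1 + r) * (1 - y) := by linarith
  have hx0 : 0 < x := lt_of_lt_of_le (by positivity) e1
  have hx1 : 0 < 1 - x := lt_of_lt_of_le (by positivity) e3
  have hlog1 := Real.log_le_log (by positivity) e1
  have hlog2 := Real.log_le_log hx0 e2
  have hlog3 := Real.log_le_log (by positivity) e3
  have hlog4 := Real.log_le_log hx1 e4
  rw [Real.log_mul (by positivity) (by positivity)] at hlog1 hlog2 hlog3 hlog4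
  have hxne : x ≠ 1 := fun hx => by linarith
  rw [logOddsWeight, if_neg hx0.ne', if_neg hxne]
  rw [Real.log_div hx0.ne' hx1.ne', Real.log_div hy0.ne' hy1'.ne',
    Real.log_div (by positivity) hr1'.ne', abs_le]
  constructor <;> linarith

/-- If the majority vote is correct with probability near one, the weights that the pseudo competences
produce are nearly proportional to the ideal weights. -/
theorem abs_artanh_div_meanSign_sub_le {p : ℕ → ℝ} {γ η : ℝ} (hγ : 0 < γ)
    (hp : ∀ i, p i ∈ Set.Ioo γ (1 - γ)) (hη0 : 0 < η) (hη : η ≤ 1 / 100) {A : Finset ℕ}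
    (hA : 1 - meanSign p A ≤ η * γ ^ 4 / 8) {i : ℕ} (hi : i ∈ A) :
    meanSign p (A.erase i) ∈ Set.Ioc (0 : ℝ) 1 ∧ 99 / 100 ≤ meanSign p A ∧
    |Real.artanh (meanSign p (A.erase i) * (2 * p i - 1)) / meanSign p A -
        Real.artanh (2 * p i - 1)| ≤
      η * |Real.artanh (2 * p i - 1)| *
        (|2 * p i - 1| + (∑ j ∈ A, |2 * p j - 1|) / A.card) := by
  have hp' : ∀ i, p i ∈ Set.Icc (0 : ℝ) 1 :=
    fun i => ⟨by linarith [(hp i).1], by linarith [(hp i).2]⟩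
  have hγ2 : γ < 1 / 2 := by linarith [(hp 0).1, (hp 0).2]
  have hγsq : γ ^ 2 ≤ 1 := by nlinarith
  have hγ4 : γ ^ 4 ≤ γ ^ 2 := by
    rw [show γ ^ 4 = γ ^ 2 * γ ^ 2 by ring]
    exact mul_le_of_le_one_left (sq_nonneg γ) hγsq
  have hdiff := abs_meanSign_erase_sub_le hγ hp hi
  set c := meanSign p A with hc
  set c' := meanSign p (A.erase i) with hc'
  set m := 2 * p i - 1 with hm
  set D := (∑ j ∈ A, |2 * p j - 1|) / (A.card : ℝ) with hD
  set a := Real.artanh m with ha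
  have hcle : c ≤ 1 := meanSign_le_one hp' A
  have hc'le : c' ≤ 1 := meanSign_le_one hp' _
  have hmabs : ∀ j, |2 * p j - 1| ≤ 1 := fun j =>
    abs_le.2 ⟨by linarith [(hp' j).1], by linarith [(hp' j).2]⟩
  have hcard : (0 : ℝ) < A.card := by exact_mod_cast Finset.card_pos.2 ⟨i, hi⟩
  have hD0 : 0 ≤ D := by positivity
  have hD1 : D ≤ 1 := by
    refine div_le_one_of_le₀ ?_ hcard.le
    calc ∑ j ∈ A, |2 * p j - 1| ≤ ∑ j ∈ A, (1 : ℝ) := Finset.sum_le_sum fun j _ => hmabs j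
      _ = A.card := by simp
  have hη4 : η * γ ^ 4 ≤ η * γ ^ 2 := mul_le_mul_of_nonneg_left hγ4 hη0.le
  have hηγ : η * γ ^ 2 ≤ 1 / 100 := (mul_le_of_le_one_right hη0.le hγsq).trans hη
  have hc99 : 99 / 100 ≤ c := by linarith
  have hquot : (1 - c) / γ ^ 2 ≤ η * γ ^ 2 / 8 := by
    rw [div_le_iff₀ (by positivity)]
    refine hA.trans (le_of_eq ?_)
    ring
  have hm1 : |m| ≤ 1 := hmabs i
  have hdiff2 : |c' - c| ≤ η * γ ^ 2 / 8 * (|m| + D) :=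
    hdiff.trans (mul_le_mul_of_nonneg_right hquot (by positivity))
  have hdiff3 : |c' - c| ≤ η * γ ^ 2 / 4 := by
    refine hdiff2.trans ?_
    have : η * γ ^ 2 / 8 * (|m| + D) ≤ η * γ ^ 2 / 8 * 2 := by
      gcongr
      linarith
    linarith
  have hc'pos : 0 < c' := by
    have := (abs_le.1 hdiff3).1
    linarith
  have hmIoo : m ∈ Set.Ioo (-1 : ℝ) 1 := ⟨by linarith [(hp i).1], by linarith [(hp i).2]⟩
  obtain ⟨h1, h2⟩ := abs_artanh_mul_div_sub_le hc'pos hc'le hmIoo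
  rw [← ha] at h1 h2
  refine ⟨⟨hc'pos, hc'le⟩, hc99, ?_⟩
  have hcpos : 0 < c := by linarith
  -- Two sources of error: leaving out i changes c to c', costing η/4, and artanh is not linear,
  -- costing 3η/4.
  have h3 : Real.artanh (c' * m) / c - a =
      Real.artanh (c' * m) / c' * ((c' - c) / c) + (Real.artanh (c' * m) / c' - a) := by
    field_simp
    ring
  have h4 : |(c' - c) / c| ≤ η / 4 * (|m| + D) := by
    rw [abs_div, abs_of_pos hcpos, div_le_iff₀ hcpos]
    refine hdiff2.trans ?_
    have h0 : 0 ≤ η * (|m| + D) := by positivity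
    have h01 := mul_le_mul_of_nonneg_left hγsq h0
    have h02 := mul_le_mul_of_nonneg_left hc99 h0
    linarith
  have h5 : (1 - c' ^ 2) * m ^ 2 / (1 - m ^ 2) ^ 2 ≤ 3 * η / 4 * (|m| + D) := by
    -- Here 1 - m² = 4 p i (1 - p i) ≥ 4γ(1 - γ) ≥ γ.
    have hden : γ ^ 2 ≤ (1 - m ^ 2) ^ 2 := by
      refine pow_le_pow_left₀ hγ.le ?_ 2
      rw [hm]
      have h01 := mul_nonneg (sub_nonneg.2 (hp i).1.le) (sub_nonneg.2 (hp i).2.le)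
      have h02 := mul_nonneg hγ.le (sub_nonneg.2 hγ2.le)
      linarith
    have hnum : 1 - c' ^ 2 ≤ 3 * η / 4 * γ ^ 2 := by
      have := (abs_le.1 hdiff3).1
      have h01 := sq_nonneg (1 - c')
      linarith
    have hmsq : m ^ 2 ≤ |m| + D := by
      rw [← sq_abs, sq]
      linarith [mul_le_of_le_one_left (abs_nonneg m) hm1]
    have h0 : 0 < (1 - m ^ 2) ^ 2 := lt_of_lt_of_le (by positivity) hden
    rw [div_le_iff₀ h0]
    calc (1 - c' ^ 2) * m ^ 2 ≤ 3 * η / 4 * γ ^ 2 * (|m| + D) :=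
          mul_le_mul hnum hmsq (sq_nonneg m) (by positivity)
      _ = 3 * η / 4 * (|m| + D) * γ ^ 2 := by ring
      _ ≤ _ := by gcongr
  rw [h3]
  refine (abs_add_le _ _).trans ?_
  rw [abs_mul]
  have h6 := mul_le_mul h2 h4 (abs_nonneg _) (abs_nonneg a)
  have h7 := h1.trans (mul_le_mul_of_nonneg_right h5 (abs_nonneg a))
  linarith

section Model

variable {Ω : Type*} [MeasurableSpace Ω] {μ : Measure Ω} [IsProbabilityMeasure μ]
  {p : ℕ → ℝ} {Y : ℕ → Ω → ℝ} {X : ℕ → ℕ → Ω → ℝ}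

/-- The pseudo competence of an expert in the committee of the first `N` experts. -/
def pseudoCompetence (p : ℕ → ℝ) (N i : ℕ) : ℝ :=
  1 / 2 + (p i - 1 / 2) * meanSign p ((Finset.range N).erase i)

theorem empiricalPseudoCompetence_tail (h : IsOpinionModel μ p Y X) {tie : ℕ → Finset ℕ → ℝ}
    (htie : ∀ t A, tie t A = 1 ∨ tie t A = -1) (N i : ℕ) {T : ℕ} (hT : 1 ≤ T)
    (hq : pseudoCompetence p N i ∈ Set.Icc (0 : ℝ) 1) {r : ℝ} (hr : 0 ≤ r) (hr' : r ≤ 22 / 25) :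
    μ.real {ω | r * min (pseudoCompetence p N i) (1 - pseudoCompetence p N i) ≤
      |empiricalPseudoCompetence X tie N T i ω - pseudoCompetence p N i|} ≤
      2 * Real.exp (-(T * min (pseudoCompetence p N i) (1 - pseudoCompetence p N i) *
        (3 / 8 * r ^ 2))) := by
  classical
  set E : ℕ → Set Ω := fun t =>
    {ω | X i t ω = majorityVote (tie t) ((Finset.range N).erase i) fun j => X j t ω} with hE
  have hEm : ∀ t, MeasurableSet (E t) := fun t =>
    measurableSet_eq_fun (h.measurable_opinion i t) (measurable_majorityVote h _ _ t)
  have hind : iIndepFun (fun t => (E t).indicator (fun _ => (1 : ℝ))) μ := by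
    have hg : ∀ t, Measurable fun z : ℝ × (ℕ → ℝ) =>
        if z.2 i = majorityVote (tie t) ((Finset.range N).erase i) z.2 then (1 : ℝ) else 0 := by
      intro t
      have hX : ∀ j, Measurable fun z : ℝ × (ℕ → ℝ) => z.2 j := fun j =>
        (measurable_pi_apply j).comp measurable_snd
      refine Measurable.ite (measurableSet_eq_fun (hX i) ?_) measurable_const measurable_const
      exact (measurable_signWithTie _).comp (Finset.measurable_sum _ fun j _ => hX j)
    have := h.tasks_indep.comp _ hg
    convert this using 2 with t
    funext ω
    simp [Set.indicator_apply, hE]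
  have := bernoulli_average_tail hEm hind hq
    (fun t => real_agreement_eq h (htie t) (Finset.notMem_erase i _) t) hT hr hr'
  convert this using 9 with ω
  simp only [empiricalPseudoCompetence, Set.indicator_apply, hE, Set.mem_ofPred_eq]

/-- Union bound over the experts' estimates. When all are good, each term of the signed vote moves
by at most κ, so a wrong decision leaves a margin of at most N κ for the exact pseudo weights. -/
theorem blockRule_error_le (h : IsOpinionModel μ p Y X) {tie : ℕ → Finset ℕ → ℝ}
    (htie : ∀ t A, tie t A = 1 ∨ tie t A = -1) {N T : ℕ} (hT : 1 ≤ T)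
    {γ r κ : ℝ} (hq : ∀ i ∈ Finset.range N, pseudoCompetence p N i ∈ Set.Ioo γ (1 - γ))
    (hγ : 0 < γ) (hr : 0 ≤ r) (hr' : r ≤ 22 / 25)
    (hκ : Real.log ((1 + r) / (1 - r)) ≤ κ) {tieB w₀ w₁ : ℝ} (t : ℕ) :
    μ.real {ω | blockRule X tie tieB w₀ w₁ N T t ω ≠ Y t ω} ≤
      N * (2 * Real.exp (-(T * γ * (3 / 8 * r ^ 2)))) +
        μ.real {ω | (∑ i ∈ Finset.range N, X i t ω *
          Real.log (pseudoCompetence p N i / (1 - pseudoCompetence p N i))) * Y t ω ≤ N * κ} := by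
  set bad : ℕ → Set Ω := fun i =>
    {ω | r * min (pseudoCompetence p N i) (1 - pseudoCompetence p N i) ≤
      |empiricalPseudoCompetence X tie N T i ω - pseudoCompetence p N i|} with hbad
  set G : Set Ω := {ω | (∑ i ∈ Finset.range N, X i t ω *
    Real.log (pseudoCompetence p N i / (1 - pseudoCompetence p N i))) * Y t ω ≤ N * κ} with hG
  have hsub : {ω | blockRule X tie tieB w₀ w₁ N T t ω ≠ Y t ω} ⊆
      (⋃ i ∈ Finset.range N, bad i) ∪ G := by
    intro ω hω
    by_cases hb : ω ∈ ⋃ i ∈ Finset.range N, bad i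
    · exact Or.inl hb
    right
    simp only [Set.mem_iUnion, not_exists] at hb
    rw [Set.mem_ofPred_eq, blockRule, signWithTie] at hω
    set F := ∑ i ∈ Finset.range N,
      X i t ω * logOddsWeight w₀ w₁ (empiricalPseudoCompetence X tie N T i ω) with hF
    have hFY : F * Y t ω ≤ 0 := by
      rcases h.state_values t ω with hy | hy
      · rw [hy, mul_one]
        by_contra hneg
        rw [if_pos (not_le.1 hneg)] at hω
        exact hω hy.symm
      · rw [hy, mul_neg, mul_one]
        by_contra hneg
        have hF0 : F < 0 := by linarith
        rw [if_neg hF0.not_gt, if_pos hF0] at hω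
        exact hω hy.symm
    have hXY : ∀ i, |X i t ω * Y t ω| = 1 := by
      intro i
      rcases h.opinion_values i t ω with h1 | h1 <;> rcases h.state_values t ω with h2 | h2 <;>
        rw [h1, h2] <;> norm_num
    have hterm : ∀ i ∈ Finset.range N, X i t ω *
        Real.log (pseudoCompetence p N i / (1 - pseudoCompetence p N i)) * Y t ω ≤
        X i t ω * logOddsWeight w₀ w₁ (empiricalPseudoCompetence X tie N T i ω) * Y t ω + κ := by
      intro i hi
      have hlt := hb i hi
      simp only [hbad, Set.mem_ofPred_eq, not_le] at hlt
      have hqi := hq i hi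
      have hw := (abs_logOdds_sub_le hr (by linarith) ⟨by linarith [hqi.1], by linarith [hqi.2]⟩
        hlt w₀ w₁).trans hκ
      set u := logOddsWeight w₀ w₁ (empiricalPseudoCompetence X tie N T i ω)
      set v := Real.log (pseudoCompetence p N i / (1 - pseudoCompetence p N i))
      have h1 : X i t ω * Y t ω * (v - u) ≤ κ := by
        refine (le_abs_self _).trans ?_
        rw [abs_mul, hXY, one_mul, abs_sub_comm]
        exact hw
      linarith
    rw [hG, Set.mem_ofPred_eq, Finset.sum_mul]
    refine (Finset.sum_le_sum hterm).trans ?_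
    rw [Finset.sum_add_distrib, ← Finset.sum_mul, ← hF]
    simp only [Finset.sum_const, Finset.card_range, nsmul_eq_mul]
    linarith
  refine (measureReal_mono hsub).trans ((measureReal_union_le _ _).trans ?_)
  refine add_le_add ((measureReal_biUnion_finset_le _ _).trans ?_) le_rfl
  have hbound : ∀ i ∈ Finset.range N,
      μ.real (bad i) ≤ 2 * Real.exp (-(T * γ * (3 / 8 * r ^ 2))) := by
    intro i hi
    have hqi := hq i hi
    refine (empiricalPseudoCompetence_tail h htie N i hT
      ⟨by linarith [hqi.1], by linarith [hqi.2]⟩ hr hr').trans ?_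
    have : γ ≤ min (pseudoCompetence p N i) (1 - pseudoCompetence p N i) :=
      le_min hqi.1.le (by linarith [hqi.2])
    gcongr
  refine (Finset.sum_le_sum hbound).trans (le_of_eq ?_)
  simp

end Model

end

/-! ### Chernoff's bound with the pseudo weights, and the theorem. -/

theorem log_div_one_sub_eq_artanh {x : ℝ} (hx : x ∈ Set.Ioo (0 : ℝ) 1) :
    Real.log (x / (1 - x)) = 2 * Real.artanh (2 * x - 1) := by
  rw [Real.artanh_eq_half_log ⟨by linarith [hx.1], by linarith [hx.2]⟩,
    show 1 + (2 * x - 1) = 2 * x by ring, show 1 - (2 * x - 1) = 2 * (1 - x) by ring,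
    mul_div_mul_left _ _ two_ne_zero]
  ring

theorem committeePotential_eq {p : ℕ → ℝ} (hp : ∀ i, p i ∈ Set.Ioo (0 : ℝ) 1) (N : ℕ) :
    2 * committeePotential p N = ∑ i ∈ Finset.range N,
      2 * (Real.artanh (2 * p i - 1) * Real.tanh (Real.artanh (2 * p i - 1))) := by
  rw [committeePotential, Finset.mul_sum]
  refine Finset.sum_congr rfl fun i _ => ?_
  rw [log_div_one_sub_eq_artanh (hp i),
    Real.tanh_artanh ⟨by linarith [(hp i).1], by linarith [(hp i).2]⟩]
  ring

/-- A committee whose majority vote is wrong with probability at most `θ`, for a small `θ` that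
depends on the balancing parameter only, decides well with the weights given by the pseudo
competences. -/
theorem exists_pseudo_naive_bayes_bound {p : ℕ → ℝ} {γ : ℝ} (hγ : 0 < γ)
    (hp : ∀ i, p i ∈ Set.Ioo γ (1 - γ)) :
    ∃ θ : ℝ, 0 < θ ∧ θ ≤ 1 / 2 ∧ ∀ N : ℕ, 0 < N → 1 - meanSign p (Finset.range N) ≤ θ →
      (∀ i ∈ Finset.range N, meanSign p ((Finset.range N).erase i) ∈ Set.Ioc (0 : ℝ) 1) ∧
      ∀ {Ω : Type*} [MeasurableSpace Ω] (μ : Measure Ω) [IsProbabilityMeasure μ]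
        (Y : ℕ → Ω → ℝ) (X : ℕ → ℕ → Ω → ℝ), IsOpinionModel μ p Y X →
        ∀ ε : ℝ, 0 < ε → ε < 2 * committeePotential p N / N → ∀ t : ℕ,
        μ.real {ω | (∑ i ∈ Finset.range N, X i t ω *
          Real.log (pseudoCompetence p N i / (1 - pseudoCompetence p N i))) * Y t ω ≤
            N * (97 / 100 * ε)} ≤
          Real.exp (-(2 * committeePotential p N - ε * N) ^ 2 /
            (8 * committeePotential p N)) := by
  have hp01 : ∀ i, p i ∈ Set.Ioo (0 : ℝ) 1 :=
    fun i => ⟨by linarith [(hp i).1], by linarith [(hp i).2]⟩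
  have hp' : ∀ i, p i ∈ Set.Icc (0 : ℝ) 1 := fun i => ⟨(hp01 i).1.le, (hp01 i).2.le⟩
  have hγ2 : γ < 1 / 2 := by linarith [(hp 0).1, (hp 0).2]
  set a : ℕ → ℝ := fun i => Real.artanh (2 * p i - 1) with ha
  have hmIoo : ∀ i, 2 * p i - 1 ∈ Set.Ioo (-1 : ℝ) 1 :=
    fun i => ⟨by linarith [(hp01 i).1], by linarith [(hp01 i).2]⟩
  have htanh : ∀ i, Real.tanh (a i) = 2 * p i - 1 := fun i => Real.tanh_artanh (hmIoo i)
  set M := Real.artanh (1 - 2 * γ) with hM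
  have haM : ∀ i, |a i| ≤ M := by
    intro i
    rw [ha, abs_artanh _ (hmIoo i)]
    refine Real.artanh_le_artanh (by linarith [abs_nonneg (2 * p i - 1)]) (by linarith) ?_
    exact abs_le.2 ⟨by linarith [(hp i).1], by linarith [(hp i).2]⟩
  have hcM := Real.cosh_pos (3 * M)
  -- The first bound on η serves the first-order errors, the second the second-order ones; both
  -- depend on γ only.
  set η := min (1 / 100) (1 / (48 * Real.cosh (3 * M) ^ 2)) with hη
  have hη0 : 0 < η := lt_min (by norm_num) (by positivity)
  have hη1 : η ≤ 1 / 100 := min_le_left _ _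
  have hη2 : η ^ 2 ≤ 1 / (48 * Real.cosh (3 * M) ^ 2) := by
    refine le_trans ?_ (min_le_right (1 / 100) _)
    rw [← hη, sq]
    exact mul_le_of_le_one_left hη0.le (by linarith)
  refine ⟨η * γ ^ 4 / 8, by positivity, ?_, ?_⟩
  · have : η * γ ^ 4 ≤ 1 / 100 * 1 := by
      gcongr
      exact pow_le_one₀ hγ.le (by linarith)
    linarith
  intro N hN hθ
  have hweights := fun i (hi : i ∈ Finset.range N) =>
    abs_artanh_div_meanSign_sub_le hγ hp hη0 hη1 hθ hi
  refine ⟨fun i hi => (hweights i hi).1, ?_⟩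
  intro Ω _ μ _ Y X h ε hε hεΦ t
  have hN' : (0 : ℝ) < N := by exact_mod_cast hN
  have hc : 99 / 100 ≤ meanSign p (Finset.range N) :=
    (hweights 0 (Finset.mem_range.2 hN)).2.1
  set c := meanSign p (Finset.range N) with hcdef
  have hc0 : 0 < c := by linarith
  set b : ℕ → ℝ := fun i =>
    Real.artanh (meanSign p ((Finset.range N).erase i) * (2 * p i - 1)) / c with hb
  rw [lt_div_iff₀ hN'] at hεΦ
  set Φ := committeePotential p N with hΦ
  have hεN : 0 < ε * N := by positivity
  have hΦ0 : 0 < Φ := by linarith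
  -- Minimizer of 2Φ(l² - l) + l ε N; the minimum is -2Φ l².
  set l := 1 / 2 * (1 - ε * N / (2 * Φ)) with hl
  have hl0 : 0 < l := by
    have : ε * N / (2 * Φ) < 1 := (div_lt_one (by positivity)).2 hεΦ
    rw [hl]
    linarith
  have hl1 : 1 - 2 * l = ε * N / (2 * Φ) := by rw [hl]; ring
  have hl2 : l ≤ 1 / 2 := by
    have : 0 ≤ ε * N / (2 * Φ) := by positivity
    linarith
  have hl3 : 2 * Φ * (1 - 2 * l) = ε * N := by
    rw [hl1]
    field_simp
  have hw : ∀ i ∈ Finset.range N,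
      Real.log (pseudoCompetence p N i / (1 - pseudoCompetence p N i)) = 2 * (c * b i) := by
    intro i hi
    obtain ⟨h1, h2⟩ := (hweights i hi).1
    have hm := hmIoo i
    have he : 2 * pseudoCompetence p N i - 1 =
        meanSign p ((Finset.range N).erase i) * (2 * p i - 1) := by
      rw [pseudoCompetence]
      ring
    have habs : |meanSign p ((Finset.range N).erase i) * (2 * p i - 1)| < 1 := by
      rw [abs_mul, abs_of_pos h1]
      exact (mul_le_of_le_one_left (abs_nonneg _) h2).trans_lt (abs_lt.2 hm)
    rw [← he] at habs
    have habs' := abs_lt.1 habs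
    rw [log_div_one_sub_eq_artanh ⟨by linarith [habs'.1], by linarith [habs'.2]⟩, he]
    simp only [hb]
    field_simp
  -- The tilt l / c cancels the common factor c of the weights; the price is the threshold divided
  -- by c ≥ 99/100.
  have hchernoff := real_weighted_sum_le h hp' (Finset.range N)
    (fun i => Real.log (pseudoCompetence p N i / (1 - pseudoCompetence p N i)))
    (N * (97 / 100 * ε)) (div_pos hl0 hc0).le t
  refine hchernoff.trans ?_
  have hfactor : ∀ i ∈ Finset.range N,
      p i * Real.exp (-(l / c * Real.log (pseudoCompetence p N i / (1 - pseudoCompetence p N i)))) +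
        (1 - p i) *
          Real.exp (l / c * Real.log (pseudoCompetence p N i / (1 - pseudoCompetence p N i))) =
      Real.cosh (a i - 2 * l * b i) / Real.cosh (a i) := by
    intro i hi
    rw [hw i hi, show l / c * (2 * (c * b i)) = 2 * l * b i by field_simp,
      ← cosh_sub_two_mul_div_cosh, htanh]
    ring_nf
  rw [Finset.prod_congr rfl hfactor]
  have hprod := prod_cosh_div_cosh_le N a b haM hη0.le hη1 hη2 hl0 hl2 fun i hi => by
    have := (hweights i hi).2.2
    rw [Finset.card_range] at this
    simpa only [htanh] using this
  have hA : ∑ i ∈ Finset.range N, 2 * (a i * Real.tanh (a i)) = 2 * Φ :=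
    (committeePotential_eq hp01 N).symm
  rw [hA] at hprod
  refine (mul_le_mul_of_nonneg_left hprod (Real.exp_pos _).le).trans ?_
  rw [← Real.exp_add, Real.exp_le_exp]
  have hrhs : -(2 * Φ - ε * N) ^ 2 / (8 * Φ) = -(2 * Φ * l ^ 2) := by
    rw [← hl3]
    field_simp
    ring
  rw [hrhs]
  have hlc : l / c ≤ l * (100 / 99) := by
    rw [div_le_iff₀ hc0]
    nlinarith
  have h1 : l / c * (N * (97 / 100 * ε)) ≤ l * (100 / 99) * (N * (97 / 100 * ε)) := by gcongr
  have h2 : 2 * Φ * (l ^ 2 - l + 2 * η * l * (1 - 2 * l)) =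
      -(2 * Φ * l ^ 2) - l * (ε * N) + 2 * η * (l * (ε * N)) := by
    rw [← hl3]
    ring
  have h3 : 0 ≤ l * (ε * N) := by positivity
  -- In units of l ε N, threshold and perturbation cost 97/99 + 2/100 < 1.
  have h4 := mul_le_mul_of_nonneg_right hη1 h3
  rw [h2]
  linarith

theorem theorem4 (p : ℕ → ℝ) :
    ∃ nstar : ℕ, ∀ {Ω : Type*} [MeasurableSpace Ω] (μ : Measure Ω) [IsProbabilityMeasure μ]
      (Y : ℕ → Ω → ℝ) (X : ℕ → ℕ → Ω → ℝ), IsOpinionModel μ p Y X →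
      ∀ tie : ℕ → Finset ℕ → ℝ, (∀ t A, tie t A = 1 ∨ tie t A = -1) →
      IsConsistent μ Y X tie →
      ∀ N : ℕ, nstar < N → ∀ T : ℕ, 1 ≤ T →
      ∀ δ ∈ Set.Ioo (0 : ℝ) 1,
      ∀ ε ∈ Set.Ioo
          ((rateRatio (consistencyRate μ Y X tie N) * sampleConstant δ N T) ^ ((1 : ℝ) / 3))
          (min 5 (2 * committeePotential p N / N)),
      ∀ γ : ℝ, IsAbsolutelyBalanced p γ →
        sampleConstant δ N T * (2 / (Real.sqrt (4 * ε + 1) - 1)) ^ 2 < γ →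
        ∀ tieB w₀ w₁ : ℝ, (tieB = 1 ∨ tieB = -1) → ∀ t : ℕ,
          μ.real {ω | blockRule X tie tieB w₀ w₁ N T t ω ≠ Y t ω} ≤
            δ + Real.exp (-(2 * committeePotential p N - ε * N) ^ 2 /
              (8 * committeePotential p N)) := by
  -- The committee size must be fixed before the model and γ, so balance and consistency are stated
  -- through p alone; if they fail, the hypotheses on the model are contradictory.
  by_cases hbal : (∃ γ, IsAbsolutelyBalanced p γ) ∧
      Tendsto (fun n => meanSign p (Finset.range n)) atTop (𝓝 1)
  swap
  · refine ⟨0, ?_⟩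
    intro Ω _ μ _ Y X h tie htie hcons N _ T _ δ _ ε _ γ hγ
    refine absurd ⟨⟨γ, hγ⟩, ?_⟩ hbal
    have h1 : majorityAccuracy μ Y X tie = fun n => (1 + meanSign p (Finset.range n)) / 2 :=
      funext fun n => majorityAccuracy_eq h htie n
    rw [IsConsistent, h1] at hcons
    have := (hcons.const_mul 2).sub_const 1
    norm_num at this
    refine this.congr fun n => ?_
    ring
  obtain ⟨⟨γ₀, ⟨hγ₀, _⟩, hp₀⟩, hlim⟩ := hbal
  obtain ⟨θ, hθ0, hθ1, hθ⟩ := exists_pseudo_naive_bayes_bound hγ₀ hp₀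
  obtain ⟨n₀, hn₀⟩ := eventually_atTop.1 (hlim.eventually (lt_mem_nhds (by linarith : 1 - θ < 1)))
  refine ⟨n₀, ?_⟩
  intro Ω _ μ _ Y X h tie htie _ N hN T hT δ hδ ε hε γ hγ hCγ tieB w₀ w₁ _ t
  obtain ⟨hδ0, hδ1⟩ := hδ
  have hN0 : 0 < N := by omega
  have hN' : (0 : ℝ) < N := by exact_mod_cast hN0
  have hN1 : (1 : ℝ) ≤ N := by exact_mod_cast hN0
  have hT' : (0 : ℝ) < T := by exact_mod_cast hT
  have hp01 : ∀ i, p i ∈ Set.Icc (0 : ℝ) 1 :=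
    fun i => ⟨by linarith [(hp₀ i).1], by linarith [(hp₀ i).2]⟩
  have hlog : 0 < Real.log (8 * N / δ) := by
    apply Real.log_pos
    rw [lt_div_iff₀ hδ0]
    linarith
  have hC : 0 < sampleConstant δ N T := mul_pos (by positivity) hlog
  have hrate : 0 ≤ rateRatio (consistencyRate μ Y X tie N) := by
    have hacc : ∀ n, majorityAccuracy μ Y X tie n = (1 + meanSign p (Finset.range n)) / 2 :=
      fun n => majorityAccuracy_eq h htie n
    have h1 : 3 / 4 ≤ consistencyRate μ Y X tie N := by
      have : Nonempty (Set.Ici N) := ⟨⟨N, Set.self_mem_Ici⟩⟩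
      refine le_ciInf fun n => ?_
      have hn : N ≤ (n : ℕ) := n.2
      have := hn₀ n (by omega)
      rw [hacc]
      linarith
    have h2 : consistencyRate μ Y X tie N ≤ 1 := by
      refine (ciInf_le ⟨0, ?_⟩ (⟨N, Set.self_mem_Ici⟩ : Set.Ici N)).trans measureReal_le_one
      rintro _ ⟨n, rfl⟩
      exact measureReal_nonneg
    exact div_nonneg (by linarith) (by linarith)
  have hε0 : 0 < ε := (Real.rpow_nonneg (mul_nonneg hrate hC.le) _).trans_lt hε.1
  have hε5 : ε < 5 := hε.2.trans_le (min_le_left _ _)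
  have hεΦ : ε < 2 * committeePotential p N / N := hε.2.trans_le (min_le_right _ _)
  obtain ⟨⟨hγ0, _⟩, hp⟩ := hγ
  obtain ⟨hsign, hbound⟩ := hθ N hN0 (by linarith [hn₀ N hN.le])
  -- The positive root of s² + s = ε; the condition on γ then reads C / s² < γ.
  set s := (Real.sqrt (4 * ε + 1) - 1) / 2 with hs
  have hsqrt : Real.sqrt (4 * ε + 1) = 2 * s + 1 := by rw [hs]; ring
  have hs2 : s ^ 2 + s = ε := by
    have := Real.sq_sqrt (by linarith : 0 ≤ 4 * ε + 1)
    rw [hsqrt] at this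
    linarith
  have hs0 : 0 < s := by
    have : 1 < Real.sqrt (4 * ε + 1) := Real.lt_sqrt_of_sq_lt (by linarith)
    linarith
  have hs1 : s ≤ 11 / 6 := by
    by_contra hneg
    have := not_le.1 hneg
    nlinarith
  -- The accuracy r = (12/25) s meets two demands: 2r + 4r² = 0.96 s + 0.9216 s² ≤ 0.97 ε, and 12 ·
  -- (3/8) · (12/25)² = 1.0368 ≥ 1 for the tail. From s ≤ 11/6 follows r ≤ 22/25.
  have hr0 : 0 ≤ 12 / 25 * s := by positivity
  have hr1 : 12 / 25 * s ≤ 22 / 25 := by linarith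
  have hκ : Real.log ((1 + 12 / 25 * s) / (1 - 12 / 25 * s)) ≤ 97 / 100 * ε := by
    refine (log_one_add_div_one_sub_le hr0 hr1).trans ?_
    have := sq_nonneg s
    rw [← hs2]
    linarith
  -- A pseudo competence lies between 1/2 and p i, so it inherits the balance γ.
  have hq : ∀ i ∈ Finset.range N, pseudoCompetence p N i ∈ Set.Ioo γ (1 - γ) := by
    intro i hi
    obtain ⟨h1, h2⟩ := hsign i hi
    have hγ12 : γ < 1 / 2 := by linarith [(hp i).1, (hp i).2]
    obtain ⟨h3, h4⟩ := hp i
    set c := meanSign p ((Finset.range N).erase i)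
    rw [pseudoCompetence]
    constructor
    · nlinarith
    · nlinarith
  have hmain := blockRule_error_le h htie hT hq hγ0 hr0 hr1 hκ (tieB := tieB) (w₀ := w₀)
    (w₁ := w₁) t
  refine hmain.trans (add_le_add ?_ (hbound μ Y X h ε hε0 hεΦ t))
  have hexp : Real.log (8 * N / δ) ≤ T * γ * (3 / 8 * (12 / 25 * s) ^ 2) := by
    rw [hsqrt, show 2 / (2 * s + 1 - 1) = 1 / s by field_simp; ring, sampleConstant, div_pow, one_pow,
      mul_one_div, div_lt_iff₀ (by positivity), div_mul_eq_mul_div, div_lt_iff₀ hT'] at hCγ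
    have : 0 ≤ γ * s ^ 2 * T := by positivity
    linarith
  have hδ8 : Real.exp (-(T * γ * (3 / 8 * (12 / 25 * s) ^ 2))) ≤ δ / (8 * N) := by
    calc _ ≤ Real.exp (-Real.log (8 * N / δ)) := Real.exp_le_exp.2 (neg_le_neg hexp)
      _ = δ / (8 * N) := by
        rw [Real.exp_neg, Real.exp_log (by positivity), inv_div]
  calc (N : ℝ) * (2 * Real.exp (-(T * γ * (3 / 8 * (12 / 25 * s) ^ 2)))) ≤
        N * (2 * (δ / (8 * N))) := by gcongr
    _ = δ / 4 := by
      field_simp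
      norm_num
    _ ≤ δ := by linarith
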